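/- Setting. Let $N\ge 1$ be an integer, $\mathbb T_N=\mathbb Z/N\mathbb Z$ (identified with $\{0,\dots,N-1\}$), $\Omega=\{\pm1\}^{\mathbb T_N}$, and $(\tau_x\eta)_z=\eta_{z+x}$. For $\sigma\in\mathbb R$ let $\mathbb E_\sigma$ be the expectation under the product Bernoulli measure on $\Omega$ with one-site means $\sigma$. Let $\mathfrak l_{\mathfrak d}\ge1$ be an integer and let $\mathfrak d:\Omega\to\mathbb R$ satisfy $|\mathfrak d|\le B$ and depend only on $\eta_x$ with $x\in\{-\mathfrak l_{\mathfrak d},\dots,\mathfrak l_{\mathfrak d}\}$ (mod $N$). Put $$\mathfrak q=\tfrac12\mathfrak d-\tfrac12\mathfrak d\,\eta_0\eta_1,\quad \tilde{\mathfrak q}=\mathfrak q\circ\tau_{-2\mathfrak l_{\mathfrak d}},\quad \bar{\mathfrak d}=\partial_\sigma\mathbb E_\sigma\tilde{\mathfrak q}\,|_{\sigma=0},\quad \bar{\mathfrak q}=\tilde{\mathfrak q}-\mathbb E_0\tilde{\mathfrak q}-\bar{\mathfrak d}\,\eta_0,\quad \tilde{\mathfrak s}=-\tilde{\mathfrak q}\sum_{y=0}^{2\mathfrak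 l_{\mathfrak d}-1}\eta_{-y},$$ $$\mathrm R=\tfrac N2-\tfrac1{24}-\tfrac12N^{1/2}\,\mathbb E_0(\mathfrak d-\mathfrak d\,\eta_0\eta_1)+\tfrac12\bar{\mathfrak d}+\mathbb E_0\tilde{\mathfrak s}.$$ A trajectory of the exclusion process is a right-continuous step path $(\eta_t)_{t\ge0}$ in $\Omega$ with left limits, all of whose jumps exchange one particle and one hole at two neighbouring sites $x,x+1$. Let $J_T$ be its net flux over the bond $\{0,1\}$ during $[0,T]$ (jumps $1\to0$ minus jumps $0\to1$), and define, for $x\in\{0,\dots,N-1\}$, $$\mathbf h^N_{T,x}=2N^{-1/2}J_T+N^{-1/2}\sum_{y=1}^x\eta_{T,y},\qquad \mathbf Z^N_{T,x}=\exp(-\mathbf h^N_{T,x}+\mathrm RT).$$ Write $\|\phi\|_{t}=\sup_{(s,x)\in[0,t]\times\mathbb T_N}|\phi_{s,x}|$, $\nabla^{\mathbf X}_k\phi_{t,x}=\phi_{t,x+k}-\phi_{t,x}$ and $\nabla^{\mathbf T}_{s}\phi_{t,x}=\phi_{(1\wedge(t+s))\vee0,\,x}-\phi_{t,x}$. Let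 $\varepsilon_{\mathrm{RN}}=999^{-999}$, let $\varepsilon_{\mathrm{ap}}>0$ satisfy $999^{999}\varepsilon_{\mathrm{ap}}\le\varepsilon_{\mathrm{RN}}$, and let $\mathbb I^{\mathbf T}$ be the set of all $kN^{-2+j\varepsilon_{\mathrm{ap}}}$ with integers $1\le k\le N^{\varepsilon_{\mathrm{ap}}}$, $j\ge0$ and $N^{-2+j\varepsilon_{\mathrm{ap}}}\le N^{-1}$. With $\inf\emptyset=\infty$, let $\mathfrak t_{\mathrm{st}}$ be the minimum of $1$ and of the infima of those $t\in[0,1]$ for which, respectively, $$\|\mathbf Z^N\|_t+\|(\mathbf Z^N)^{-1}\|_t\ge N^{\varepsilon_{\mathrm{ap}}},$$ $$\sup_{s\in\mathbb I^{\mathbf T}}s^{-1/4}\|\nabla^{\mathbf T}_{-s}\mathbf Z^N\|_t\ge N^{\varepsilon_{\mathrm{ap}}}\bigl(1+\|\mathbf Z^N\|_t^2\bigr),$$ $$\sup_{1\le|k|\le N^{1/2+\varepsilon_{\mathrm{RN}}}}N^{1/2}|k|^{-1/2}\|\nabla^{\mathbf X}_k\mathbf Z^N\|_t\ge N^{\varepsilon_{\mathrm{ap}}}\bigl(1+\|\mathbf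 Z^N\|_t\bigr)^2.$$ Let $\mathbf Y^N_{T,x}=\mathbf Z^N_{T,x}\mathbf 1(T\le\mathfrak t_{\mathrm{st}})$. For $\delta\ge0$ let $\mathsf A_\delta(\eta)$ be the average of $\eta_{-w}$ over the integers $0\le w\le N^\delta$, and let $\mathsf E^{\mathrm{can}}_\delta(\eta)$ be the conditional expectation under $\mathbb E_0$ of $\bar{\mathfrak q}$ given that $\mathsf A_\delta$ takes the value $\mathsf A_\delta(\eta)$ (the canonical-ensemble expectation of $\bar{\mathfrak q}$ on the block $-\{0,\dots,\lfloor N^\delta\rfloor\}$). Let $\mathbf H^N_{S,T,x,y}$ be the heat kernel with $\mathbf H^N_{S,S,x,y}=\mathbf 1_{x=y}$ and $\partial_T\mathbf H^N_{S,T,x,y}=\mathscr L_N\mathbf H^N_{S,T,x,y}$, where $\mathscr L_N$ acts on $x$ by $$\mathscr L_N\phi_x=\tfrac12N^2(\phi_{x+1}+\phi_{x-1}-2\phi_x)+\bar{\mathfrak d}N(\phi_{x-1}-\phi_x),$$ and let $\mathbf H^N_{T,x}(\phi)=\int_0^T\sum_{y\in\mathbb T_N}\mathbf H^N_{S,T,x,y}\,\phi_{S,y}\,dS$.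 Proposition (deterministic inverse-length-scale bound). Let $\varepsilon_1>0$ and $0<\varepsilon_{\mathrm{RN},1}\le999^{-999}\varepsilon_{\mathrm{RN}}$, and let $\mathfrak b_+$ be the largest integer $\mathfrak b\ge0$ with $\varepsilon_1+\mathfrak b\,\varepsilon_{\mathrm{RN},1}\le\frac12+\varepsilon_{\mathrm{RN}}$ (assumed to exist). There are constants $C$ and $N_0$ depending only on $\mathfrak l_{\mathfrak d}$ and $B$ (and not on $\varepsilon_1,\varepsilon_{\mathrm{RN},1},\varepsilon_{\mathrm{ap}}$) such that for all $N\ge N_0$, all $\mathfrak d$ as above, and every trajectory with $\sum_{x}\eta_{0,x}=0$, the integrals defining the heat operator below converge absolutely and $$\sup_{(T,x)\in[0,1]\times\mathbb T_N}\Bigl|\mathbf H^N_{T,x}\bigl(N^{1/2}\,\mathsf E^{\mathrm{can}}_{\varepsilon_1+\mathfrak b_+\varepsilon_{\mathrm{RN},1}}(\tau_y\eta_S)\,\mathbf Y^N_{S,y}\bigr)\Bigr|\le C\,N^{-\frac{99}{100}\varepsilon_{\mathrm{RN}}+10\varepsilon_{\mathrm{ap}}}.$$ -/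

import Mathlib

open Filter Topology
open scoped ENNReal

noncomputable section

namespace SpeedChangeKPZ

/-! ### Configurations and product Bernoulli expectations -/

/-- The state space `{±1}^{𝕋_N}`, with `𝕋_N = ℤ/Nℤ`. -/
abbrev Config (N : ℕ) := ZMod N → ℤˣ

/-- The real value `η_x ∈ {1, -1}`. -/
def spin {N : ℕ} (η : Config N) (x : ZMod N) : ℝ := ((η x : ℤ) : ℝ)

/-- The shift `(τ_x η)_z = η_{z+x}`. -/
def shift {N : ℕ} (x : ZMod N) (η : Config N) : Config N := fun z => η (z + x)

/-- The configuration `η^{x,x+1}` with the occupation numbers at `x` and `x+1` swapped. -/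
def swapAt {N : ℕ} (x : ZMod N) (η : Config N) : Config N := η ∘ Equiv.swap x (x + 1)

/-- The image in `𝕋_N` of the discrete interval `⟦-l, l⟧`. -/
def centeredBlock (N l : ℕ) : Set (ZMod N) :=
  (fun k : ℤ => (k : ZMod N)) '' Set.Icc (-(l : ℤ)) (l : ℤ)

/-- `E_σ f`: expectation of `f` under the product Bernoulli measure on `{±1}^{𝕋_N}` whose
one-site marginals have mean `σ`, i.e. give mass `(1 ± σ)/2` to `±1`. -/
def bernoulliE {N : ℕ} [NeZero N] (σ : ℝ) (f : Config N → ℝ) : ℝ :=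
  ∑ η : Config N, (∏ x, (1 + σ * spin η x) / 2) * f η

/-! ### The functionals built from the environment-dependent asymmetry `d` -/

section functionals

variable {N : ℕ}

/-- `q = d/2 - d η_0 η_1 / 2`. -/
def qFun (d : Config N → ℝ) (η : Config N) : ℝ :=
  1 / 2 * d η - 1 / 2 * d η * (spin η 0 * spin η 1)

/-- `q̃ = τ_{-2l} q`, whose support is strictly to the left of `0`. -/
def qTilde (l : ℕ) (d : Config N → ℝ) (η : Config N) : ℝ :=
  qFun d (shift (-(2 * (l : ZMod N))) η)

/-- `d̄ = ∂_σ E_σ q̃ |_{σ=0}` (the derivative of a polynomial in `σ`). -/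
def dBar [NeZero N] (l : ℕ) (d : Config N → ℝ) : ℝ :=
  deriv (fun σ : ℝ => bernoulliE σ (qTilde l d)) 0

/-- `q̄ = q̃ - E_0 q̃ - d̄ η_0`. -/
def qBar [NeZero N] (l : ℕ) (d : Config N → ℝ) (η : Config N) : ℝ :=
  qTilde l d η - bernoulliE 0 (qTilde l d) - dBar l d * spin η 0

/-- `s̃ = - q̃ · ∑_{y=0}^{2l-1} η_{-y}`. -/
def sTilde (l : ℕ) (d : Config N → ℝ) (η : Config N) : ℝ :=
  -qTilde l d η * ∑ y ∈ Finset.range (2 * l), spin η (-(y : ZMod N))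

/-- The renormalization constant
`R = (N/2 - 1/24) + (N^{1/2} R_{2,1} + d̄/2 + R_{2,3})`, where
`R_{2,1} = -E_0(d - d η_0 η_1)/2` and `R_{2,3} = E_0 s̃`. -/
def renorm (N : ℕ) [NeZero N] (l : ℕ) (d : Config N → ℝ) : ℝ :=
  ((N : ℝ) / 2 - 1 / 24) +
    ((N : ℝ) ^ (1 / 2 : ℝ) *
        (-(1 / 2) * bernoulliE 0 (fun η => d η - d η * (spin η 0 * spin η 1)))
      + 1 / 2 * dBar l d + bernoulliE 0 (sTilde l d))

/-! ### Canonical-ensemble expectations on mesoscopic blocks -/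

/-- `A_δ(η)`, the average of `η` over the block `-⟦0, N^δ⟧`. -/
def blockAvg (δ : ℝ) (η : Config N) : ℝ :=
  (∑ w ∈ Finset.range (⌊(N : ℝ) ^ δ⌋₊ + 1), spin η (-(w : ZMod N))) /
    ((⌊(N : ℝ) ^ δ⌋₊ + 1 : ℕ) : ℝ)

/-- `E_0(f | A_δ)` evaluated at `η`: the conditional expectation of `f` under the uniform measure
on `{±1}^{𝕋_N}` given that the average over the block `-⟦0, N^δ⟧` is that of `η`. For `f` supported
in the block this is the expectation of `f` under the canonical measure on the block with
density parameter `A_δ(η)`. The denominator is positive, since `η` lies in the event. -/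
def canE [NeZero N] (δ : ℝ) (f : Config N → ℝ) (η : Config N) : ℝ :=
  bernoulliE 0 (Set.indicator {ζ : Config N | blockAvg δ ζ = blockAvg δ η} f) /
    bernoulliE 0 (Set.indicator {ζ : Config N | blockAvg δ ζ = blockAvg δ η} fun _ => 1)

end functionals

/-! ### Trajectories of the exclusion process, height function, Gartner transform -/

/-- One admissible transition of the pair (configuration, net leftward flux over the bond `{0,1}`):
either nothing happens, or a particle and a hole at some pair `x, x+1` exchange their positions;
for `x = 0` the flux changes by `+1` if the particle jumps from `1` to `0` and by `-1` if it jumps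
from `0` to `1`. -/
def IsStep {N : ℕ} (η : Config N) (J : ℤ) (η' : Config N) (J' : ℤ) : Prop :=
  (η' = η ∧ J' = J) ∨
    ∃ x : ZMod N, η x ≠ η (x + 1) ∧ η' = swapAt x η ∧
      J' = J + if x = 0 then (if η 1 = 1 then 1 else -1) else 0

/-- A realization of the exclusion process on `𝕋_N` together with its net flux: a right-continuous
step path (only times `t ≥ 0` matter) with left limits, all of whose jumps are single
nearest-neighbour particle jumps. The net flux `J_T` counts the leftward minus the rightward
particle jumps over the bond `{0,1}` during `[0,T]`. -/
structure Trajectory (N : ℕ) where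
  /-- the configuration `η_t` -/
  η : ℝ → Config N
  /-- the net leftward particle flux over the bond `{0,1}` up to time `t` -/
  flux : ℝ → ℤ
  flux_zero : flux 0 = 0
  right_continuous : ∀ t : ℝ, 0 ≤ t → ∀ᶠ s in 𝓝[>] t, η s = η t ∧ flux s = flux t
  jumps : ∀ t : ℝ, 0 < t → ∃ (η' : Config N) (J' : ℤ),
    (∀ᶠ s in 𝓝[<] t, η s = η' ∧ flux s = J') ∧ IsStep η' J' (η t) (flux t)

section dynamics

variable {N : ℕ}

/-- The height function `h_{T,x} = h_{T,0} + N^{-1/2} ∑_{y=1}^x η_{T,y}` with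
`h_{T,0} = 2 N^{-1/2} J_T`, for `x ∈ {0, …, N-1}`. -/
def height (X : Trajectory N) (T : ℝ) (x : ZMod N) : ℝ :=
  2 * (N : ℝ) ^ (-(1 / 2) : ℝ) * (X.flux T : ℝ) +
    (N : ℝ) ^ (-(1 / 2) : ℝ) * ∑ y ∈ Finset.Icc 1 x.val, spin (X.η T) (y : ZMod N)

/-- The Gartner transform `Z_{T,x} = exp(-h_{T,x} + R T)`. -/
def gartner [NeZero N] (l : ℕ) (d : Config N → ℝ) (X : Trajectory N) (T : ℝ) (x : ZMod N) : ℝ :=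
  Real.exp (-height X T x + renorm N l d * T)

/-! ### Space-time norms, gradients, stopping times -/

/-- `‖φ‖_{t;𝕋_N} = sup_{(s,y) ∈ [0,t] × 𝕋_N} |φ_{s,y}|`, with values in `[0,∞]`. -/
def stNorm (t : ℝ) (φ : ℝ → ZMod N → ℝ) : ℝ≥0∞ :=
  ⨆ s ∈ Set.Icc (0 : ℝ) t, ⨆ y : ZMod N, ENNReal.ofReal |φ s y|

/-- `∇^X_k φ_{t,x} = φ_{t,x+k} - φ_{t,x}`. -/
def gradX (k : ℤ) (φ : ℝ → ZMod N → ℝ) (t : ℝ) (x : ZMod N) : ℝ :=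
  φ t (x + (k : ZMod N)) - φ t x

/-- `∇^T_s φ_{t,x} = φ_{(1 ∧ (t+s)) ∨ 0, x} - φ_{t,x}`. -/
def gradT (s : ℝ) (φ : ℝ → ZMod N → ℝ) (t : ℝ) (x : ZMod N) : ℝ :=
  φ (max (min 1 (t + s)) 0) x - φ t x

/-- `ε_RN = 999^{-999}`. -/
def epsRN : ℝ := ((999 : ℝ) ^ 999)⁻¹

/-- The length-scale `𝔩_N = N^{1/2 + ε_RN}`. -/
def lenScale (N : ℕ) : ℝ := (N : ℝ) ^ (1 / 2 + epsRN)

/-- The time-scales `k N^{-2 + j ε_ap}` with `1 ≤ k ≤ N^{ε_ap}`, `j ≥ 0`, and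
`N^{-2 + j ε_ap} ≤ N^{-1}`. -/
def timeScales (N : ℕ) (εap : ℝ) : Set ℝ :=
  {s | ∃ k j : ℕ, 1 ≤ k ∧ (k : ℝ) ≤ (N : ℝ) ^ εap ∧
    (N : ℝ) ^ (-2 + (j : ℝ) * εap) ≤ (N : ℝ) ^ (-1 : ℝ) ∧
    s = (k : ℝ) * (N : ℝ) ^ (-2 + (j : ℝ) * εap)}

/-- `inf {t ∈ [0,1] : P t} ∧ 1`, with `inf ∅ = ∞`. -/
def firstTime (P : ℝ → Prop) : ℝ := sInf ({t : ℝ | t ∈ Set.Icc (0 : ℝ) 1 ∧ P t} ∪ {1})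

/-- `𝔱_ap`, for a space-time function `Z`. -/
def tAp (εap : ℝ) (Z : ℝ → ZMod N → ℝ) : ℝ :=
  firstTime fun t =>
    ENNReal.ofReal ((N : ℝ) ^ εap) ≤ stNorm t Z + stNorm t (fun s x => (Z s x)⁻¹)

/-- `𝔱_RN^T`, for a space-time function `Z`. -/
def tTime (εap : ℝ) (Z : ℝ → ZMod N → ℝ) : ℝ :=
  firstTime fun t =>
    ENNReal.ofReal ((N : ℝ) ^ εap) * (1 + stNorm t Z ^ 2) ≤
      ⨆ s ∈ timeScales N εap, ENNReal.ofReal (s ^ (-(1 / 4) : ℝ)) * stNorm t (gradT (-s) Z)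

/-- `𝔱_RN^X`, for a space-time function `Z`. -/
def tSpace (εap : ℝ) (Z : ℝ → ZMod N → ℝ) : ℝ :=
  firstTime fun t =>
    ENNReal.ofReal ((N : ℝ) ^ εap) * (1 + stNorm t Z) ^ 2 ≤
      ⨆ k ∈ {k : ℤ | 1 ≤ |k| ∧ ((|k| : ℤ) : ℝ) ≤ lenScale N},
        ENNReal.ofReal ((N : ℝ) ^ (1 / 2 : ℝ) * ((|k| : ℤ) : ℝ) ^ (-(1 / 2) : ℝ)) *
          stNorm t (gradX k Z)

/-- `𝔱_st = 𝔱_ap ∧ 𝔱_RN^T ∧ 𝔱_RN^X`. -/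
def tSt (εap : ℝ) (Z : ℝ → ZMod N → ℝ) : ℝ :=
  min (tAp εap Z) (min (tTime εap Z) (tSpace εap Z))

/-- `Y_{T,x} = Z_{T,x} 1(T ≤ 𝔱_st)`, with `Z` the Gartner transform. -/
def stoppedGartner [NeZero N] (l : ℕ) (d : Config N → ℝ) (εap : ℝ) (X : Trajectory N)
    (T : ℝ) (x : ZMod N) : ℝ :=
  Set.indicator (Set.Iic (tSt εap (gartner l d X))) (fun S => gartner l d X S x) T

/-! ### Heat kernel and heat operator -/

/-- `𝓛_N = Δ^{!!}/2 + a ∇^!_{-1}` acting on functions on `𝕋_N`, where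
`Δ^{!!} φ_x = N² (φ_{x+1} + φ_{x-1} - 2 φ_x)` and `∇^!_{-1} φ_x = N (φ_{x-1} - φ_x)`. -/
def heatGen (a : ℝ) (φ : ZMod N → ℝ) (x : ZMod N) : ℝ :=
  1 / 2 * ((N : ℝ) ^ 2 * (φ (x + 1) + φ (x - 1) - 2 * φ x)) +
    a * ((N : ℝ) * (φ (x - 1) - φ x))

/-- The matrix of `𝓛_N`. -/
def heatMatrix (N : ℕ) [NeZero N] (a : ℝ) : Matrix (ZMod N) (ZMod N) ℝ :=
  Matrix.of fun x y => heatGen a (Pi.single y 1) x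

/-- The heat kernel `H_{S,T,x,y}`, the `(x,y)` entry of `exp((T-S) 𝓛_N)`. It is the solution of
`H_{S,S,x,y} = 1_{x=y}`, `∂_T H_{S,T,x,y} = 𝓛_N H_{S,T,x,y}` (with `𝓛_N` acting on `x`); see
`heatKernel_self` and `hasDerivAt_heatKernel`. -/
def heatKernel (N : ℕ) [NeZero N] (a S T : ℝ) (x y : ZMod N) : ℝ :=
  NormedSpace.exp ((T - S) • heatMatrix N a) x y

theorem heatKernel_self [NeZero N] (a S : ℝ) (x y : ZMod N) :
    heatKernel N a S S x y = if x = y then 1 else 0 := by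
  simp [heatKernel, Matrix.one_apply]

theorem heatMatrix_mulVec [NeZero N] (a : ℝ) (φ : ZMod N → ℝ) :
    (heatMatrix N a).mulVec φ = heatGen a φ := by
  ext x
  simp only [Matrix.mulVec, dotProduct, heatMatrix, Matrix.of_apply, heatGen, add_mul, mul_add,
    sub_mul, mul_sub, Finset.sum_add_distrib, Finset.sum_sub_distrib, mul_assoc,
    ← Finset.mul_sum]
  simp [Pi.single_apply]

theorem hasDerivAt_heatKernel [NeZero N] (a S T : ℝ) (x y : ZMod N) :
    HasDerivAt (fun T => heatKernel N a S T x y)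
      (heatGen a (fun z => heatKernel N a S T z y) x) T := by
  let _ := Matrix.linftyOpNormedRing (n := ZMod N) (α := ℝ)
  let _ := Matrix.linftyOpNormedAlgebra (n := ZMod N) (R := ℝ) (α := ℝ)
  have h := hasDerivAt_exp_smul_const' (𝕂 := ℝ) (heatMatrix N a) (T - S)
  have h1 := h.comp_sub_const T S
  have h2 := (hasDerivAt_pi.1 ((hasDerivAt_pi.1 h1) x)) y
  rw [← heatMatrix_mulVec]
  exact h2

/-- The space-time heat operator
`H_{T,x}(φ) = ∫_0^T ∑_y H_{S,T,x,y} φ_{S,y} dS`. -/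
def heatOp (N : ℕ) [NeZero N] (a : ℝ) (φ : ℝ → ZMod N → ℝ) (T : ℝ) (x : ZMod N) : ℝ :=
  ∫ S in (0 : ℝ)..T, ∑ y : ZMod N, heatKernel N a S T x y * φ S y

/-- The function `(S,y) ↦ N^{1/2} E^can_δ(τ_y η_S) Y_{S,y}`. -/
def canForcing [NeZero N] (l : ℕ) (d : Config N → ℝ) (εap δ : ℝ) (X : Trajectory N)
    (S : ℝ) (y : ZMod N) : ℝ :=
  (N : ℝ) ^ (1 / 2 : ℝ) * canE δ (qBar l d) (shift y (X.η S)) * stoppedGartner l d εap X S y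

end dynamics

end SpeedChangeKPZ

end

open SpeedChangeKPZ

/-! The estimate is pointwise in the forcing, followed by the maximum principle; no cancellation in
space or time is needed. Write `a = N ^ εap`, let `M` be the number of sites in the block and `A`
its average spin.

Equivalence of ensembles: expanded in Walsh functions, the canonical expectation of `qBar` has no
contribution of degree 0 or 1. The constant is subtracted explicitly, and by exchangeability every
single spin has canonical mean `A`, so the linear part cancels against `dBar` times the spin at the
origin. Degrees at least two contribute O(A² + 1/M), by a recursion in the degree
(`canSum_recursion`, `abs_canSum_le_of_two_le`, `abs_canE_qBar_le`).

A priori control of `A`: a block sum of spins is `N^{1/2}` times a height increment, hence an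
increment of the logarithm of the Gartner transform. Strictly before the stopping time, the gradient
bound together with the bound on the inverse transform gives A² = O(a⁸/M) (`abs_sum_spin_le`,
`blockAvg_sq_le`). Zero total spin, conserved by the dynamics, makes the height periodic, so that
blocks may wrap around the torus.

With M ≥ N^δ and one more factor `a` from the stopped transform, the forcing is O(N^{1/2 - δ + 9
εap}), and maximality of the number of steps puts δ within `epsRN / 100` of 1/2 + `epsRN`. For large
`N` the heat kernel is a stochastic matrix, so integrating over a time at most 1 preserves the
bound. -/

noncomputable section

namespace SpeedChangeKPZ

/-! ### Walsh functions and product Bernoulli expectations -/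

section Walsh

variable {N : ℕ}

/-- The Walsh function `∏_{x ∈ S} η_x`. -/
def walsh (S : Finset (ZMod N)) (η : Config N) : ℝ := ∏ x ∈ S, spin η x

theorem spin_mul_self (η : Config N) (x : ZMod N) : spin η x * spin η x = 1 := by
  rcases Int.units_eq_one_or (η x) with h | h <;> simp [spin, h]

theorem abs_spin (η : Config N) (x : ZMod N) : |spin η x| = 1 := by
  rcases Int.units_eq_one_or (η x) with h | h <;> simp [spin, h]

theorem abs_walsh (S : Finset (ZMod N)) (η : Config N) : |walsh S η| = 1 := by
  simp [walsh, Finset.abs_prod, abs_spin]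

theorem walsh_insert {S : Finset (ZMod N)} {x : ZMod N} (hx : x ∉ S) (η : Config N) :
    walsh (insert x S) η = spin η x * walsh S η := by
  simp [walsh, Finset.prod_insert hx]

theorem spin_mul_walsh_of_mem {S : Finset (ZMod N)} {x : ZMod N} (hx : x ∈ S) (η : Config N) :
    spin η x * walsh S η = walsh (S.erase x) η := by
  rw [← Finset.insert_erase hx, walsh_insert (Finset.notMem_erase x S), ← mul_assoc,
    spin_mul_self, one_mul, Finset.insert_erase hx]

/-- A bounded function of the spins in `S₀` is a combination of Walsh functions with bounded
coefficients. -/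
theorem exists_walsh_expansion (B : ℝ) (S₀ : Finset (ZMod N)) :
    ∀ f : Config N → ℝ, DependsOn f (S₀ : Set (ZMod N)) → (∀ η, |f η| ≤ B) →
      ∃ c : Finset (ZMod N) → ℝ, (∀ S, |c S| ≤ B) ∧
        ∀ η, f η = ∑ S ∈ S₀.powerset, c S * walsh S η := by
  induction S₀ using Finset.induction_on with
  | empty =>
    intro f hf hB
    -- A function of no spins is constant; its value is read off at the all-ones configuration.
    refine ⟨fun _ => f 1, fun _ => hB 1, fun η => ?_⟩
    simp only [Finset.powerset_empty, Finset.sum_singleton, walsh, Finset.prod_empty, mul_one]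
    exact hf (by simp)
  | insert x s hx ih =>
    intro f hf hB
    have dep : ∀ u : ℤˣ, DependsOn (fun η => f (Function.update η x u)) (s : Set (ZMod N)) := by
      intro u η ζ h
      apply hf
      intro z hz
      by_cases hzx : z = x
      · subst hzx; simp
      · rw [Function.update_of_ne hzx, Function.update_of_ne hzx]
        refine h z ?_
        simpa [hzx] using hz
    have bd : ∀ (u : ℤˣ) (η : Config N), |f (Function.update η x u)| ≤ B := fun u η => hB _
    -- Split into even and odd parts in the spin at `x`. Half-sums and half-differences are still
    -- bounded by `B`, so the coefficient bound does not grow along the induction.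
    obtain ⟨cg, hcg, hg⟩ := ih
      (fun η => (f (Function.update η x 1) + f (Function.update η x (-1))) / 2)
      (fun η ζ h => by
        have h1 := dep 1 h
        have h2 := dep (-1) h
        simp only at h1 h2 ⊢
        rw [h1, h2])
      (fun η => by
        have h1 := abs_le.1 (bd 1 η)
        have h2 := abs_le.1 (bd (-1) η)
        rw [abs_le]; constructor <;> linarith)
    obtain ⟨ch, hch, hh⟩ := ih
      (fun η => (f (Function.update η x 1) - f (Function.update η x (-1))) / 2)
      (fun η ζ h => by
        have h1 := dep 1 h
        have h2 := dep (-1) h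
        simp only at h1 h2 ⊢
        rw [h1, h2])
      (fun η => by
        have h1 := abs_le.1 (bd 1 η)
        have h2 := abs_le.1 (bd (-1) η)
        rw [abs_le]; constructor <;> linarith)
    refine ⟨fun S => if x ∈ S then ch (S.erase x) else cg S, fun S => ?_, fun η => ?_⟩
    · dsimp only
      split_ifs
      · exact hch _
      · exact hcg _
    · rw [Finset.sum_powerset_insert hx]
      have e1 : ∑ S ∈ s.powerset, (if x ∈ S then ch (S.erase x) else cg S) * walsh S η =
          ∑ S ∈ s.powerset, cg S * walsh S η := by
        refine Finset.sum_congr rfl fun S hS => ?_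
        rw [if_neg fun h => hx (Finset.mem_powerset.1 hS h)]
      have e2 : ∑ S ∈ s.powerset, (if x ∈ insert x S then ch ((insert x S).erase x)
            else cg (insert x S)) * walsh (insert x S) η =
          spin η x * ∑ S ∈ s.powerset, ch S * walsh S η := by
        rw [Finset.mul_sum]
        refine Finset.sum_congr rfl fun S hS => ?_
        have hxS : x ∉ S := fun h => hx (Finset.mem_powerset.1 hS h)
        rw [if_pos (Finset.mem_insert_self x S), Finset.erase_insert hxS, walsh_insert hxS]
        ring
      rw [e1, e2, ← hg, ← hh]
      rcases Int.units_eq_one_or (η x) with h | h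
      · have hu : Function.update η x 1 = η := by rw [← h, Function.update_eq_self]
        rw [hu]; simp [spin, h]; ring
      · have hu : Function.update η x (-1) = η := by rw [← h, Function.update_eq_self]
        rw [hu]; simp [spin, h]; ring

/-- Independence: the sum over configurations factors over sites, each site of `S` contributing its
mean and every other site its total mass 1. -/
theorem bernoulliE_walsh [NeZero N] (σ : ℝ) (S : Finset (ZMod N)) :
    bernoulliE σ (walsh S) = σ ^ S.card := by
  have h1 : ∀ η : Config N, (∏ x, (1 + σ * spin η x) / 2) * walsh S η =
      ∏ x, (1 + σ * ((η x : ℤ) : ℝ)) / 2 * (if x ∈ S then ((η x : ℤ) : ℝ) else 1) := by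
    intro η
    rw [Finset.prod_mul_distrib, Finset.prod_ite_mem, Finset.univ_inter]
    rfl
  unfold bernoulliE
  rw [Finset.sum_congr rfl fun η _ => h1 η,
    ← Fintype.prod_sum (fun (x : ZMod N) (u : ℤˣ) =>
      (1 + σ * ((u : ℤ) : ℝ)) / 2 * (if x ∈ S then ((u : ℤ) : ℝ) else 1))]
  have h2 : ∀ x : ZMod N, ∑ u : ℤˣ, (1 + σ * ((u : ℤ) : ℝ)) / 2 *
      (if x ∈ S then ((u : ℤ) : ℝ) else 1) = if x ∈ S then σ else 1 := by
    intro x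
    rw [UnitsInt.univ, Finset.sum_pair (by decide)]
    split_ifs <;> push_cast <;> ring
  rw [Finset.prod_congr rfl fun x _ => h2 x, Finset.prod_ite_mem, Finset.univ_inter,
    Finset.prod_const]

theorem bernoulliE_sum_walsh [NeZero N] (σ : ℝ) (F : Finset (Finset (ZMod N)))
    (c : Finset (ZMod N) → ℝ) :
    bernoulliE σ (fun η => ∑ S ∈ F, c S * walsh S η) = ∑ S ∈ F, c S * σ ^ S.card := by
  simp only [← bernoulliE_walsh, bernoulliE, Finset.mul_sum]
  rw [Finset.sum_comm]
  exact Finset.sum_congr rfl fun S _ => Finset.sum_congr rfl fun η _ => by ring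

/-- The derivative at `σ = 0` of a Bernoulli expectation picks out the linear coefficients. -/
theorem deriv_bernoulliE_sum_walsh [NeZero N] (F : Finset (Finset (ZMod N)))
    (c : Finset (ZMod N) → ℝ) :
    deriv (fun σ : ℝ => bernoulliE σ (fun η => ∑ S ∈ F, c S * walsh S η)) 0 =
      ∑ S ∈ F, if S.card = 1 then c S else 0 := by
  simp only [bernoulliE_sum_walsh]
  have h : HasDerivAt (fun σ : ℝ => ∑ S ∈ F, c S * σ ^ S.card)
      (∑ S ∈ F, c S * ((S.card : ℝ) * (0 : ℝ) ^ (S.card - 1))) 0 :=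
    HasDerivAt.fun_sum fun S _ => (hasDerivAt_pow S.card (0 : ℝ)).const_mul (c S)
  rw [h.deriv]
  refine Finset.sum_congr rfl fun S _ => ?_
  split_ifs with h1
  · simp [h1]
  · rcases Nat.eq_zero_or_pos S.card with h0 | h0
    · simp [h0]
    · have : S.card - 1 ≠ 0 := by omega
      simp [this]

theorem bernoulliE_zero [NeZero N] (f : Config N → ℝ) :
    bernoulliE 0 f = (1 / 2) ^ N * ∑ η, f η := by
  simp [bernoulliE, Finset.mul_sum, ZMod.card]

end Walsh

/-! ### Walsh functions under canonical measures -/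

section Canonical

variable {N : ℕ} [NeZero N]

open scoped Classical in
/-- The configurations whose spins in the block `Λ` sum to `m`. -/
def hyperplane (Λ : Finset (ZMod N)) (m : ℝ) : Finset (Config N) :=
  Finset.univ.filter fun ζ => ∑ x ∈ Λ, spin ζ x = m

/-- The unnormalized canonical expectation of a Walsh function. -/
def canSum (Λ : Finset (ZMod N)) (m : ℝ) (S : Finset (ZMod N)) : ℝ :=
  ∑ ζ ∈ hyperplane Λ m, walsh S ζ

variable {Λ : Finset (ZMod N)} {m : ℝ}

theorem mem_hyperplane {ζ : Config N} : ζ ∈ hyperplane Λ m ↔ ∑ x ∈ Λ, spin ζ x = m := by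
  simp [hyperplane]

theorem canSum_empty : canSum Λ m ∅ = (hyperplane Λ m).card := by simp [canSum, walsh]

theorem abs_canSum_le (S : Finset (ZMod N)) : |canSum Λ m S| ≤ (hyperplane Λ m).card := by
  refine (Finset.abs_sum_le_sum_abs _ _).trans ?_
  simp [abs_walsh]

/-- Exchangeability of the canonical measure. -/
theorem canSum_insert_eq {S : Finset (ZMod N)} {x y : ZMod N} (hx : x ∈ Λ) (hy : y ∈ Λ)
    (hxS : x ∉ S) (hyS : y ∉ S) : canSum Λ m (insert x S) = canSum Λ m (insert y S) := by
  -- Both sites lie in `Λ`, so exchanging their spins permutes the terms of the block sum.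
  have hmem : ∀ ζ : Config N, ζ ∈ hyperplane Λ m → ζ ∘ Equiv.swap x y ∈ hyperplane Λ m := by
    intro ζ hζ
    rw [mem_hyperplane] at hζ ⊢
    rw [← hζ]
    refine Finset.sum_equiv (Equiv.swap x y) (fun z => ?_) (fun z _ => rfl)
    by_cases h1 : z = x
    · subst h1; simp [hx, hy]
    by_cases h2 : z = y
    · subst h2; simp [hx, hy]
    rw [Equiv.swap_apply_of_ne_of_ne h1 h2]
  refine Finset.sum_bij' (fun ζ _ => ζ ∘ Equiv.swap x y) (fun ζ _ => ζ ∘ Equiv.swap x y)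
    hmem hmem (fun ζ _ => ?_) (fun ζ _ => ?_) (fun ζ _ => ?_)
  · ext z; simp
  · ext z; simp
  · rw [walsh_insert hxS, walsh_insert hyS]
    congr 1
    · simp [spin]
    · refine Finset.prod_congr rfl fun z hz => ?_
      have h1 : z ≠ x := fun h => hxS (h ▸ hz)
      have h2 : z ≠ y := fun h => hyS (h ▸ hz)
      simp [spin, Equiv.swap_apply_of_ne_of_ne h1 h2]

/-- Multiply the Walsh function by the total block spin, which is `m` on the hyperplane. A site
outside `S` raises the degree, with the same result for all such sites by exchangeability; a site
inside `S` is erased, since spins square to 1. -/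
theorem canSum_recursion {S : Finset (ZMod N)} {x : ZMod N} (hS : S ⊆ Λ) (hx : x ∈ Λ)
    (hxS : x ∉ S) :
    ((Λ.card : ℝ) - S.card) * canSum Λ m (insert x S) =
      m * canSum Λ m S - ∑ z ∈ S, canSum Λ m (S.erase z) := by
  have h1 : m * canSum Λ m S = ∑ z ∈ Λ, ∑ ζ ∈ hyperplane Λ m, spin ζ z * walsh S ζ := by
    rw [Finset.sum_comm, canSum, Finset.mul_sum]
    refine Finset.sum_congr rfl fun ζ hζ => ?_
    rw [← Finset.sum_mul, mem_hyperplane.1 hζ]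
  have h2 : ∑ z ∈ Λ \ S, ∑ ζ ∈ hyperplane Λ m, spin ζ z * walsh S ζ =
      ((Λ.card : ℝ) - S.card) * canSum Λ m (insert x S) := by
    have : ∀ z ∈ Λ \ S, ∑ ζ ∈ hyperplane Λ m, spin ζ z * walsh S ζ =
        canSum Λ m (insert x S) := by
      intro z hz
      rw [Finset.mem_sdiff] at hz
      rw [canSum_insert_eq hx hz.1 hxS hz.2]
      exact Finset.sum_congr rfl fun ζ _ => (walsh_insert hz.2 ζ).symm
    rw [Finset.sum_congr rfl this, Finset.sum_const, Finset.card_sdiff_of_subset hS,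
      nsmul_eq_mul, Nat.cast_sub (Finset.card_le_card hS)]
  have h3 : ∑ z ∈ S, ∑ ζ ∈ hyperplane Λ m, spin ζ z * walsh S ζ =
      ∑ z ∈ S, canSum Λ m (S.erase z) :=
    Finset.sum_congr rfl fun z hz => Finset.sum_congr rfl fun ζ _ => spin_mul_walsh_of_mem hz ζ
  rw [h1, ← Finset.sum_sdiff hS, h2, h3]
  ring

theorem card_mul_canSum_singleton {x : ZMod N} (hx : x ∈ Λ) :
    (Λ.card : ℝ) * canSum Λ m {x} = m * (hyperplane Λ m).card := by
  have h := canSum_recursion (m := m) (S := ∅) (by simp) hx (by simp)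
  simpa [canSum_empty] using h

theorem abs_le_card_of_hyperplane_nonempty (h : (hyperplane Λ m).Nonempty) : |m| ≤ Λ.card := by
  obtain ⟨ζ, hζ⟩ := h
  rw [← mem_hyperplane.1 hζ]
  refine (Finset.abs_sum_le_sum_abs _ _).trans ?_
  simp [abs_spin]

/-- Walsh functions of degree at least two have canonical expectation of the order of the squared
density plus the inverse block length. -/
theorem abs_canSum_le_of_two_le (hne : (hyperplane Λ m).Nonempty) {k : ℕ} (hk : 2 ≤ k) :
    2 * k ≤ Λ.card → ∀ S ⊆ Λ, S.card = k →
      |canSum Λ m S| ≤ 4 ^ k * ((m / Λ.card) ^ 2 + 1 / Λ.card) * (hyperplane Λ m).card := by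
  set M : ℝ := (Λ.card : ℝ) with hM
  set n : ℝ := ((hyperplane Λ m).card : ℝ) with hn
  have hn0 : 0 ≤ n := Nat.cast_nonneg _
  have hm : |m| ≤ M := abs_le_card_of_hyperplane_nonempty hne
  induction k, hk using Nat.le_induction with
  | base =>
    intro hcard S hS hS2
    obtain ⟨x, y, hxy, rfl⟩ := Finset.card_eq_two.1 hS2
    have hx : x ∈ Λ := hS (by simp)
    have hy : y ∈ Λ := hS (by simp)
    have hM4 : (4 : ℝ) ≤ M := by rw [hM]; exact_mod_cast hcard
    have r := canSum_recursion (m := m) (S := {y}) (by simpa using hy) hx (by simpa using hxy)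
    simp only [Finset.card_singleton, Finset.sum_singleton, Finset.erase_singleton,
      canSum_empty, Nat.cast_one] at r
    have r1 := card_mul_canSum_singleton (m := m) hy
    rw [← hM, ← hn] at r r1
    have hM0 : 0 < M := by linarith
    have hw : canSum Λ m {y} = m / M * n := by field_simp; linarith
    rw [hw] at r
    have e : canSum Λ m {x, y} = ((m / M) ^ 2 * M - 1) * n / (M - 1) := by
      rw [eq_div_iff (by linarith)]
      have : m * (m / M * n) = (m / M) ^ 2 * M * n := by field_simp
      linarith
    have hsq : 0 ≤ (m / M) ^ 2 := sq_nonneg _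
    rw [e, abs_div, abs_mul, abs_of_nonneg hn0, abs_of_pos (by linarith : 0 < M - 1),
      div_le_iff₀ (by linarith)]
    have h1 : |(m / M) ^ 2 * M - 1| ≤ (m / M) ^ 2 * M + 1 := by
      rw [abs_le]; constructor <;> nlinarith
    have h2 : (m / M) ^ 2 * M + 1 ≤ 4 ^ 2 * ((m / M) ^ 2 + 1 / M) * (M - 1) := by
      have : (m / M) ^ 2 * M + 1 = ((m / M) ^ 2 + 1 / M) * M := by field_simp
      rw [this]
      have : 0 ≤ (m / M) ^ 2 + 1 / M := by positivity
      nlinarith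
    calc _ ≤ (4 ^ 2 * ((m / M) ^ 2 + 1 / M) * (M - 1)) * n :=
          mul_le_mul_of_nonneg_right (h1.trans h2) hn0
      _ = _ := by ring
  | succ k hk ih =>
    intro hcard S hS hSk
    have hne' : S.Nonempty := Finset.card_pos.1 (by omega)
    obtain ⟨x, hx⟩ := hne'
    have hTk : (S.erase x).card = k := by rw [Finset.card_erase_of_mem hx, hSk]; rfl
    have hT : S.erase x ⊆ Λ := (Finset.erase_subset x S).trans hS
    have hb := ih (by omega) _ hT hTk
    have r := canSum_recursion (m := m) hT (hS hx) (Finset.notMem_erase x S)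
    rw [Finset.insert_erase hx, hTk, ← hM] at r
    have hMk : (2 * ((k : ℝ) + 1)) ≤ M := by rw [hM]; exact_mod_cast hcard
    have hk2 : (2 : ℝ) ≤ k := by exact_mod_cast hk
    have hM0 : 0 < M := by linarith
    have hsum : |∑ z ∈ S.erase x, canSum Λ m ((S.erase x).erase z)| ≤ k * n := by
      refine (Finset.abs_sum_le_sum_abs _ _).trans ?_
      refine (Finset.sum_le_card_nsmul _ _ n fun z _ => abs_canSum_le _).trans ?_
      rw [hTk, nsmul_eq_mul]
    set Q : ℝ := (m / M) ^ 2 + 1 / M with hQ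
    -- The terms with an erased site need no smallness: they carry no factor `M`, so after division
    -- by `M - k` they are of order 1/M, which `Q` dominates.
    have hQM : 1 ≤ Q * M := by
      have : Q * M = (m / M) ^ 2 * M + 1 := by rw [hQ]; field_simp
      rw [this]; nlinarith [sq_nonneg (m / M)]
    have hQ0 : 0 ≤ Q := by positivity
    have h1 : (M - k) * |canSum Λ m S| ≤ M * (4 ^ k * Q * n) + k * n := by
      rw [← abs_of_pos (by linarith : 0 < M - k), ← abs_mul, r]
      refine (abs_sub _ _).trans (add_le_add ?_ hsum)
      rw [abs_mul]
      exact mul_le_mul hm hb (abs_nonneg _) hM0.le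
    have hk4 : (k : ℝ) ≤ 4 ^ k := by exact_mod_cast (Nat.lt_pow_self (by norm_num)).le
    have h2 : (k : ℝ) * n ≤ 4 ^ k * (Q * M) * n := by
      refine mul_le_mul_of_nonneg_right ?_ hn0
      calc (k : ℝ) ≤ 4 ^ k * 1 := by linarith
        _ ≤ _ := by gcongr
    have h3 : M / 2 * |canSum Λ m S| ≤ (M - k) * |canSum Λ m S| :=
      mul_le_mul_of_nonneg_right (by linarith) (abs_nonneg _)
    -- The ratio 4 per degree: a factor 2 from `M - k ≥ M / 2`, and another from adding two terms of
    -- the same size.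
    have h4 : M / 2 * |canSum Λ m S| ≤ M / 2 * (4 ^ (k + 1) * Q * n) := by
      calc _ ≤ _ := h3
        _ ≤ _ := h1
        _ ≤ M * (4 ^ k * Q * n) + 4 ^ k * (Q * M) * n := by linarith
        _ = _ := by ring
    exact le_of_mul_le_mul_left h4 (by linarith)

end Canonical

/-! ### Canonical-ensemble expectations of `q̄` -/

section Block

variable {N : ℕ}

/-- The block `-⟦0, n - 1⟧` in `𝕋_N`. -/
def leftBlock (N n : ℕ) : Finset (ZMod N) := (Finset.range n).image fun w : ℕ => -(w : ZMod N)

theorem injOn_neg_natCast {n : ℕ} (hn : n ≤ N) :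
    Set.InjOn (fun w : ℕ => -(w : ZMod N)) (Finset.range n : Set ℕ) := by
  intro a ha b hb h
  have h' : (a : ZMod N) = (b : ZMod N) := neg_injective h
  rw [ZMod.natCast_eq_natCast_iff'] at h'
  simp only [Finset.coe_range, Set.mem_Iio] at ha hb
  rwa [Nat.mod_eq_of_lt (by omega), Nat.mod_eq_of_lt (by omega)] at h'

theorem card_leftBlock {n : ℕ} (hn : n ≤ N) : (leftBlock N n).card = n := by
  rw [leftBlock, Finset.card_image_of_injOn (injOn_neg_natCast hn), Finset.card_range]

theorem sum_leftBlock {n : ℕ} (hn : n ≤ N) (f : ZMod N → ℝ) :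
    ∑ x ∈ leftBlock N n, f x = ∑ w ∈ Finset.range n, f (-(w : ZMod N)) := by
  rw [leftBlock, Finset.sum_image (injOn_neg_natCast hn)]

theorem leftBlock_mono {m n : ℕ} (h : m ≤ n) : leftBlock N m ⊆ leftBlock N n :=
  Finset.image_subset_image (by simpa using h)

/-- At mean zero all configurations have equal weight, which cancels in the quotient. The block must
fit in the torus so that its sites are distinct and fixing the average is fixing the sum over
`leftBlock`. -/
theorem canE_eq [NeZero N] (δ : ℝ) (hδ : ⌊(N : ℝ) ^ δ⌋₊ + 1 ≤ N) (f : Config N → ℝ)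
    (η : Config N) :
    canE δ f η =
      (∑ ζ ∈ hyperplane (leftBlock N (⌊(N : ℝ) ^ δ⌋₊ + 1))
        (((⌊(N : ℝ) ^ δ⌋₊ + 1 : ℕ) : ℝ) * blockAvg δ η), f ζ) /
      (hyperplane (leftBlock N (⌊(N : ℝ) ^ δ⌋₊ + 1))
        (((⌊(N : ℝ) ^ δ⌋₊ + 1 : ℕ) : ℝ) * blockAvg δ η)).card := by
  classical
  have key : ∀ ζ : Config N, ζ ∈ hyperplane (leftBlock N (⌊(N : ℝ) ^ δ⌋₊ + 1))
      (((⌊(N : ℝ) ^ δ⌋₊ + 1 : ℕ) : ℝ) * blockAvg δ η) ↔ blockAvg δ ζ = blockAvg δ η := by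
    intro ζ
    rw [mem_hyperplane, sum_leftBlock hδ]
    conv_rhs => lhs; unfold blockAvg
    rw [div_eq_iff (by positivity), mul_comm]
  have h : ∀ g : Config N → ℝ,
      bernoulliE 0 (Set.indicator {ζ : Config N | blockAvg δ ζ = blockAvg δ η} g) =
      (1 / 2) ^ N * ∑ ζ ∈ hyperplane (leftBlock N (⌊(N : ℝ) ^ δ⌋₊ + 1))
        (((⌊(N : ℝ) ^ δ⌋₊ + 1 : ℕ) : ℝ) * blockAvg δ η), g ζ := by
    intro g
    rw [bernoulliE_zero]
    congr 1
    rw [← Finset.sum_filter_add_sum_filter_not Finset.univ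
      (fun ζ : Config N => blockAvg δ ζ = blockAvg δ η)]
    rw [Finset.sum_eq_zero (s := Finset.univ.filter fun ζ => ¬ _)
      (fun ζ hζ => Set.indicator_of_notMem (by simpa using hζ) g), add_zero]
    refine Finset.sum_congr ?_ fun ζ hζ => Set.indicator_of_mem (by
      simpa using (key ζ).1 hζ) g
    ext ζ
    rw [key]
    simp
  rw [canE, h, h, mul_div_mul_left _ _ (by positivity)]
  simp

/-- The shift moves the support of `d` to ⟦-3l, -l⟧. The spins at 0 and 1 land in the same interval
because `l ≥ 1`. -/
theorem dependsOn_qTilde {l : ℕ} (hl : 1 ≤ l) {d : Config N → ℝ}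
    (hd : DependsOn d (centeredBlock N l)) :
    DependsOn (qTilde l d) (leftBlock N (3 * l + 1) : Set (ZMod N)) := by
  intro η ζ h
  have key : ∀ k : ℤ, -(l : ℤ) ≤ k → k ≤ l →
      shift (-(2 * (l : ZMod N))) η (k : ZMod N) = shift (-(2 * (l : ZMod N))) ζ (k : ZMod N) := by
    intro k h1 h2
    refine h _ ?_
    simp only [leftBlock, Finset.coe_image, Finset.coe_range, Set.mem_image, Set.mem_Iio]
    refine ⟨(2 * (l : ℤ) - k).toNat, by omega, ?_⟩
    have : (((2 * (l : ℤ) - k).toNat : ℤ) : ZMod N) = ((2 * (l : ℤ) - k : ℤ) : ZMod N) := by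
      rw [Int.toNat_of_nonneg (by omega)]
    rw [← Int.cast_natCast, this]
    push_cast
    ring
  have hd' : d (shift (-(2 * (l : ZMod N))) η) = d (shift (-(2 * (l : ZMod N))) ζ) := by
    apply hd
    rintro _ ⟨k, ⟨h1, h2⟩, rfl⟩
    exact key k h1 h2
  have h0 := key 0 (by omega) (by omega)
  have h1 := key 1 (by omega) (by omega)
  simp only [Int.cast_zero, Int.cast_one] at h0 h1
  simp only [qTilde, qFun, spin, hd', h0, h1]

theorem abs_qTilde_le {l : ℕ} {d : Config N → ℝ} {B : ℝ} (hB : ∀ η, |d η| ≤ B) (η : Config N) :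
    |qTilde l d η| ≤ B := by
  set ζ := shift (-(2 * (l : ZMod N))) η with hζ
  have h : |spin ζ 0 * spin ζ 1| = 1 := by rw [abs_mul, abs_spin, abs_spin, mul_one]
  have h1 : |1 - spin ζ 0 * spin ζ 1| ≤ 2 := by
    have := abs_le.1 h.le
    rw [abs_le]; constructor <;> linarith
  have : qTilde l d η = 1 / 2 * (d ζ * (1 - spin ζ 0 * spin ζ 1)) := by
    simp only [qTilde, qFun, ← hζ]; ring
  rw [this, abs_mul, abs_mul, abs_of_pos (by norm_num : (0 : ℝ) < 1 / 2)]
  nlinarith [hB ζ, abs_nonneg (d ζ), abs_nonneg (1 - spin ζ 0 * spin ζ 1)]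

variable [NeZero N]

/-- `dBar` is the sum of the linear Walsh coefficients, among at most `2 ^ (3 * l + 1)` coefficients
in all. The bound is uniform in `N`, so the diffusion dominates the drift for large `N`. -/
theorem abs_dBar_le {l : ℕ} (hl : 1 ≤ l) (hN : 3 * l + 1 ≤ N) {d : Config N → ℝ}
    (hd : DependsOn d (centeredBlock N l)) {B : ℝ} (hB : ∀ η, |d η| ≤ B) :
    |dBar l d| ≤ 2 ^ (3 * l + 1) * B := by
  obtain ⟨c, hc, hf⟩ := exists_walsh_expansion B _ _ (dependsOn_qTilde hl hd) (abs_qTilde_le hB)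
  have hB0 : 0 ≤ B := (abs_nonneg _).trans (hc ∅)
  rw [dBar, funext hf, deriv_bernoulliE_sum_walsh]
  refine (Finset.abs_sum_le_sum_abs _ _).trans
    ((Finset.sum_le_card_nsmul _ _ B fun S _ => ?_).trans ?_)
  · split_ifs
    · exact hc S
    · simpa using hB0
  · rw [Finset.card_powerset, card_leftBlock hN, nsmul_eq_mul]
    push_cast; rfl

/-- The expectation of `qTilde` at mean zero is its constant coefficient, and `dBar` sums its linear
ones. Each one-spin canonical mean equals the block average, so degrees 0 and 1 cancel exactly and
only the quadratically small degrees remain. -/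
theorem abs_canE_qBar_le {l : ℕ} (hl : 1 ≤ l) {δ : ℝ} (hδ : ⌊(N : ℝ) ^ δ⌋₊ + 1 ≤ N)
    (hlδ : 2 * (3 * l + 1) ≤ ⌊(N : ℝ) ^ δ⌋₊ + 1) {d : Config N → ℝ}
    (hd : DependsOn d (centeredBlock N l)) {B : ℝ} (hB : ∀ η, |d η| ≤ B) (η : Config N) :
    |canE δ (qBar l d) η| ≤
      8 ^ (3 * l + 1) * B * (blockAvg δ η ^ 2 + 1 / ((⌊(N : ℝ) ^ δ⌋₊ + 1 : ℕ) : ℝ)) := by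
  obtain ⟨c, hc, hf⟩ := exists_walsh_expansion B _ _ (dependsOn_qTilde hl hd) (abs_qTilde_le hB)
  have hB0 : 0 ≤ B := (abs_nonneg _).trans (hc ∅)
  rw [canE_eq δ hδ]
  set n := ⌊(N : ℝ) ^ δ⌋₊ + 1 with hn
  set A := blockAvg δ η with hA
  set Λ := leftBlock N n with hΛ
  set L := leftBlock N (3 * l + 1) with hL
  have hLΛ : L ⊆ Λ := leftBlock_mono (by omega)
  have hcard : Λ.card = n := card_leftBlock hδ
  have hn0 : (0 : ℝ) < n := by exact_mod_cast (by omega : 0 < n)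
  have hne : (hyperplane Λ ((n : ℝ) * A)).Nonempty := by
    refine ⟨η, mem_hyperplane.2 ?_⟩
    rw [hΛ, sum_leftBlock hδ, hA, blockAvg, ← hn]
    field_simp
  set E : ℝ := ((hyperplane Λ ((n : ℝ) * A)).card : ℝ) with hE
  have hE0 : 0 < E := by rw [hE]; exact_mod_cast Finset.card_pos.2 hne
  have hsingle : ∀ x ∈ Λ, canSum Λ ((n : ℝ) * A) {x} = A * E := by
    intro x hx
    have := card_mul_canSum_singleton (m := (n : ℝ) * A) hx
    rw [hcard, ← hE, mul_assoc] at this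
    exact mul_left_cancel₀ hn0.ne' this
  have h0Λ : (0 : ZMod N) ∈ Λ := by
    rw [hΛ, leftBlock, Finset.mem_image]
    exact ⟨0, by simp [hn], by simp⟩
  have hE0q : bernoulliE 0 (qTilde l d) = ∑ S ∈ L.powerset, if S.card = 0 then c S else 0 := by
    rw [funext hf, bernoulliE_sum_walsh]
    refine Finset.sum_congr rfl fun S _ => ?_
    split_ifs with h <;> simp [h]
  have hdB : dBar l d = ∑ S ∈ L.powerset, if S.card = 1 then c S else 0 := by
    rw [dBar, funext hf, deriv_bernoulliE_sum_walsh]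
  have hsum : ∑ ζ ∈ hyperplane Λ ((n : ℝ) * A), qBar l d ζ =
      ∑ S ∈ L.powerset, if 2 ≤ S.card then c S * canSum Λ ((n : ℝ) * A) S else 0 := by
    have e1 : ∑ ζ ∈ hyperplane Λ ((n : ℝ) * A), qBar l d ζ =
        ∑ S ∈ L.powerset, c S * canSum Λ ((n : ℝ) * A) S - E * bernoulliE 0 (qTilde l d)
          - dBar l d * (A * E) := by
      simp only [qBar, Finset.sum_sub_distrib, Finset.sum_const, nsmul_eq_mul, ← Finset.mul_sum]
      congr 2
      · rw [Finset.sum_congr rfl fun ζ _ => hf ζ, Finset.sum_comm]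
        exact Finset.sum_congr rfl fun S _ => by rw [canSum, Finset.mul_sum]
      · rw [← hsingle 0 h0Λ, canSum]
        simp [walsh]
    rw [e1, hE0q, hdB, Finset.mul_sum, Finset.sum_mul, ← Finset.sum_sub_distrib,
      ← Finset.sum_sub_distrib]
    refine Finset.sum_congr rfl fun S hS => ?_
    rcases Nat.lt_or_ge S.card 2 with h | h
    · interval_cases hk : S.card
      · rw [Finset.card_eq_zero] at hk
        subst hk
        simp [canSum_empty, ← hE]; ring
      · obtain ⟨x, rfl⟩ := Finset.card_eq_one.1 hk
        rw [hsingle x (hLΛ (Finset.mem_powerset.1 hS (by simp)))]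
        simp
    · rw [if_pos h, if_neg (by omega), if_neg (by omega)]
      ring
  rw [hsum, abs_div, abs_of_pos hE0, div_le_iff₀ hE0]
  have hQ : 0 ≤ A ^ 2 + 1 / (n : ℝ) := by positivity
  refine (Finset.abs_sum_le_sum_abs _ _).trans
    ((Finset.sum_le_card_nsmul _ _ (B * (4 ^ (3 * l + 1) * (A ^ 2 + 1 / n) * E))
      fun S hS => ?_).trans (le_of_eq ?_))
  · split_ifs with h
    · have hSL := Finset.mem_powerset.1 hS
      have hSl : S.card ≤ 3 * l + 1 := by
        have := Finset.card_le_card hSL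
        rwa [hL, card_leftBlock (by omega)] at this
      have hb := abs_canSum_le_of_two_le hne h (by omega) S (hSL.trans hLΛ) rfl
      rw [hcard, ← hE, mul_div_cancel_left₀ _ hn0.ne'] at hb
      rw [abs_mul]
      refine mul_le_mul (hc S) (hb.trans ?_) (abs_nonneg _) hB0
      have : (4 : ℝ) ^ S.card ≤ 4 ^ (3 * l + 1) := pow_le_pow_right₀ (by norm_num) hSl
      gcongr
    · rw [abs_zero]; positivity
  · rw [Finset.card_powerset, hL, card_leftBlock (by omega), nsmul_eq_mul]
    -- The base 8 combines 2 for the number of Walsh functions and 4 from the degree recursion.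
    have : (8 : ℝ) ^ (3 * l + 1) = 2 ^ (3 * l + 1) * 4 ^ (3 * l + 1) := by
      rw [← mul_pow]; norm_num
    rw [this]; push_cast; ring

end Block

/-! ### The heat kernel is a stochastic matrix -/

section MatrixExp

variable {n : Type*} [Fintype n] [DecidableEq n]

theorem matrix_exp_nonneg {A : Matrix n n ℝ} (h : ∀ i j, 0 ≤ A i j) (i j : n) :
    0 ≤ NormedSpace.exp A i j := by
  let _ := Matrix.linftyOpNormedRing (n := n) (α := ℝ)
  let _ := Matrix.linftyOpNormedAlgebra (n := n) (R := ℝ) (α := ℝ)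
  have h1 := NormedSpace.exp_series_hasSum_exp' (𝕂 := ℝ) A
  have h2 := Pi.hasSum.1 (Pi.hasSum.1 h1 i) j
  have hpow : ∀ k : ℕ, ∀ i j, 0 ≤ (A ^ k) i j := by
    intro k
    induction k with
    | zero =>
      intro i j
      rw [pow_zero, Matrix.one_apply]
      split_ifs <;> norm_num
    | succ k ih =>
      intro i j
      rw [pow_succ, Matrix.mul_apply]
      exact Finset.sum_nonneg fun z _ => mul_nonneg (ih i z) (h z j)
  refine h2.nonneg fun k => ?_
  rw [Matrix.smul_apply, smul_eq_mul]
  exact mul_nonneg (by positivity) (hpow k i j)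

/-- The exponential of a matrix with nonnegative off-diagonal entries has nonnegative entries. -/
theorem matrix_exp_nonneg_of_offDiag {A : Matrix n n ℝ} (h : ∀ i j, i ≠ j → 0 ≤ A i j) (i j : n) :
    0 ≤ NormedSpace.exp A i j := by
  -- Adding this multiple of the identity makes all entries nonnegative; being scalar, it commutes
  -- with the matrix, and the exponential factors.
  set c : ℝ := ∑ k, |A k k| with hc
  have hA : A = (A + Matrix.diagonal fun _ => c) + Matrix.diagonal fun _ => -c := by
    rw [add_assoc, Matrix.diagonal_add]
    simp
  have hcomm : Commute (A + Matrix.diagonal fun _ => c) (Matrix.diagonal fun _ => -c) := by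
    have : (Matrix.diagonal fun _ : n => -c) = Matrix.scalar n (-c) := rfl
    rw [this]
    exact (Matrix.scalar_commute _ (fun _ => Commute.all _ _) _).symm
  rw [hA, Matrix.exp_add_of_commute _ _ hcomm, Matrix.mul_apply]
  refine Finset.sum_nonneg fun z _ => mul_nonneg (matrix_exp_nonneg (fun i j => ?_) i z) ?_
  · rw [Matrix.add_apply, Matrix.diagonal_apply]
    split_ifs with hij
    · subst hij
      have h1 : |A i i| ≤ c :=
        Finset.single_le_sum (f := fun k => |A k k|) (fun k _ => abs_nonneg _) (Finset.mem_univ i)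
      linarith [neg_abs_le (A i i)]
    · simpa using h i j hij
  · rw [Matrix.exp_diagonal, Matrix.diagonal_apply]
    split_ifs
    · rw [Pi.coe_exp, ← Real.exp_eq_exp_ℝ]
      exact (Real.exp_pos _).le
    · exact le_rfl

/-- The derivative in `t` of a row sum of exp(tA) is a row sum of exp(tA) A, which vanishes with the
row sums of `A`. Row sums therefore keep their value 1 from time 0. -/
theorem sum_matrix_exp_smul_apply {A : Matrix n n ℝ} (h : ∀ i, ∑ j, A i j = 0) (t : ℝ) (i : n) :
    ∑ j, NormedSpace.exp (t • A) i j = 1 := by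
  let _ := Matrix.linftyOpNormedRing (n := n) (α := ℝ)
  let _ := Matrix.linftyOpNormedAlgebra (n := n) (R := ℝ) (α := ℝ)
  have hder : ∀ t : ℝ, HasDerivAt (fun t : ℝ => ∑ j, NormedSpace.exp (t • A) i j) 0 t := by
    intro t
    have h1 := hasDerivAt_exp_smul_const (𝕂 := ℝ) A t
    have h2 : ∀ j, HasDerivAt (fun t : ℝ => NormedSpace.exp (t • A) i j)
        (∑ z, NormedSpace.exp (t • A) i z * A z j) t :=
      fun j => (hasDerivAt_pi.1 ((hasDerivAt_pi.1 h1) i)) j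
    have h3 := HasDerivAt.fun_sum (u := Finset.univ) fun j _ => h2 j
    have e : ∑ j, ∑ z, NormedSpace.exp (t • A) i z * A z j = 0 := by
      rw [Finset.sum_comm]
      simp [← Finset.mul_sum, h]
    rwa [e] at h3
  have := is_const_of_deriv_eq_zero (fun t => (hder t).differentiableAt)
    (fun t => (hder t).deriv) t 0
  rw [this]
  simp [Matrix.one_apply]

end MatrixExp

section HeatKernel

variable {N : ℕ} [NeZero N]

/-- The drift enters only the rate to `x - 1`, which is `N / 2 * (N + 2 * a)`; its sign is the whole
condition. -/
theorem heatMatrix_nonneg {a : ℝ} (ha : 0 ≤ (N : ℝ) + 2 * a) {x y : ZMod N} (hxy : x ≠ y) :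
    0 ≤ heatMatrix N a x y := by
  have hs : ∀ z, 0 ≤ (Pi.single y 1 : ZMod N → ℝ) z := by
    intro z
    rw [Pi.single_apply]
    split_ifs <;> norm_num
  have h0 : (Pi.single y 1 : ZMod N → ℝ) x = 0 := Pi.single_eq_of_ne hxy 1
  have hN : (0 : ℝ) ≤ N := Nat.cast_nonneg N
  simp only [heatMatrix, Matrix.of_apply, heatGen, h0]
  have e : 1 / 2 * ((N : ℝ) ^ 2 * ((Pi.single y 1 : ZMod N → ℝ) (x + 1) +
      (Pi.single y 1 : ZMod N → ℝ) (x - 1) - 2 * 0)) +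
      a * ((N : ℝ) * ((Pi.single y 1 : ZMod N → ℝ) (x - 1) - 0)) =
      (N : ℝ) ^ 2 / 2 * (Pi.single y 1 : ZMod N → ℝ) (x + 1) +
      (N : ℝ) / 2 * (N + 2 * a) * (Pi.single y 1 : ZMod N → ℝ) (x - 1) := by ring
  rw [e]
  have := hs (x + 1)
  have := hs (x - 1)
  positivity

theorem sum_heatMatrix_apply (a : ℝ) (x : ZMod N) : ∑ y, heatMatrix N a x y = 0 := by
  have h := congrFun (heatMatrix_mulVec a (fun _ : ZMod N => (1 : ℝ))) x
  simp only [Matrix.mulVec, dotProduct, mul_one] at h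
  rw [h]
  simp [heatGen]
  ring_nf; simp

theorem heatKernel_nonneg {a : ℝ} (ha : 0 ≤ (N : ℝ) + 2 * a) {S T : ℝ} (hST : S ≤ T)
    (x y : ZMod N) : 0 ≤ heatKernel N a S T x y :=
  matrix_exp_nonneg_of_offDiag (fun i j hij => by
    rw [Matrix.smul_apply, smul_eq_mul]
    exact mul_nonneg (sub_nonneg.2 hST) (heatMatrix_nonneg ha hij)) x y

theorem sum_heatKernel (a S T : ℝ) (x : ZMod N) : ∑ y, heatKernel N a S T x y = 1 :=
  sum_matrix_exp_smul_apply (sum_heatMatrix_apply a) (T - S) x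

theorem continuous_heatKernel_left (a T : ℝ) (x y : ZMod N) :
    Continuous fun S => heatKernel N a S T x y := by
  have h : Continuous fun T => heatKernel N a 0 T x y :=
    continuous_iff_continuousAt.2 fun T => (hasDerivAt_heatKernel a 0 T x y).continuousAt
  have e : (fun S => heatKernel N a S T x y) = fun S => heatKernel N a 0 (T - S) x y := by
    ext S; simp [heatKernel]
  rw [e]
  exact h.comp (continuous_const.sub continuous_id)

/-- The maximum principle for the heat kernel. -/
theorem abs_sum_heatKernel_mul_le {a : ℝ} (ha : 0 ≤ (N : ℝ) + 2 * a) {S T : ℝ} (hST : S ≤ T)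
    (x : ZMod N) {φ : ZMod N → ℝ} {K : ℝ} (hφ : ∀ y, |φ y| ≤ K) :
    |∑ y, heatKernel N a S T x y * φ y| ≤ K := by
  calc |∑ y, heatKernel N a S T x y * φ y|
      ≤ ∑ y, |heatKernel N a S T x y * φ y| := Finset.abs_sum_le_sum_abs _ _
    _ ≤ ∑ y, heatKernel N a S T x y * K := Finset.sum_le_sum fun y _ => by
        rw [abs_mul, abs_of_nonneg (heatKernel_nonneg ha hST x y)]
        exact mul_le_mul_of_nonneg_left (hφ y) (heatKernel_nonneg ha hST x y)
    _ = K := by rw [← Finset.sum_mul, sum_heatKernel, one_mul]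

end HeatKernel

/-! ### Trajectories: conservation of particles and measurability -/

section Trajectories

variable {N : ℕ}

theorem IsStep.sum_eq [NeZero N] {η η' : Config N} {J J' : ℤ} (h : IsStep η J η' J') :
    ∑ x, ((η' x : ℤˣ) : ℤ) = ∑ x, ((η x : ℤˣ) : ℤ) := by
  rcases h with ⟨rfl, -⟩ | ⟨x, -, rfl, -⟩
  · rfl
  · exact Equiv.sum_comp (Equiv.swap x (x + 1)) fun z => ((η z : ℤˣ) : ℤ)

/-- Swaps preserve the integer total spin, so it is continuous from both sides even at jump times. A
continuous integer-valued function on a half-line is constant. -/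
theorem Trajectory.sum_spin_eq [NeZero N] (X : Trajectory N) {t : ℝ} (ht : 0 ≤ t) :
    ∑ x, spin (X.η t) x = ∑ x, spin (X.η 0) x := by
  set g : ℝ → ℤ := fun s => ∑ x, ((X.η s x : ℤˣ) : ℤ) with hg
  have hright : ∀ s, 0 ≤ s → ContinuousWithinAt g (Set.Ioi s) s := by
    intro s hs
    refine tendsto_const_nhds.congr' ?_
    filter_upwards [X.right_continuous s hs] with r hr
    simp only [hg, hr.1]
  have hcont : ContinuousOn g (Set.Ici 0) := by
    intro s hs
    rcases (Set.mem_Ici.1 hs).eq_or_lt with rfl | h0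
    · exact continuousWithinAt_Ioi_iff_Ici.1 (hright 0 le_rfl)
    · refine ContinuousAt.continuousWithinAt ?_
      rw [continuousAt_iff_continuous_left'_right']
      refine ⟨?_, hright s h0.le⟩
      obtain ⟨η', J', hev, hstep⟩ := X.jumps s h0
      refine tendsto_const_nhds.congr' ?_
      filter_upwards [hev] with r hr
      simp only [hg, hr.1, hstep.sum_eq]
  have h := isPreconnected_Ici.constant hcont (Set.mem_Ici.2 ht) (Set.mem_Ici.2 le_rfl)
  simp only [spin]
  exact_mod_cast h

/-- Sample the function on the grid of mesh 1/(n+1), at the first grid point strictly to the right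
of `t`. Each sampled function factors through an integer floor, hence is measurable, and right
continuity gives pointwise convergence. -/
theorem measurable_of_continuousWithinAt_Ioi {g : ℝ → ℝ}
    (hg : ∀ t, ContinuousWithinAt g (Set.Ioi t) t) : Measurable g := by
  set u : ℕ → ℝ → ℝ := fun n t => ((⌊((n : ℝ) + 1) * t⌋ : ℝ) + 1) / ((n : ℝ) + 1) with hu
  have hlt : ∀ n t, t < u n t := by
    intro n t
    have hn : (0 : ℝ) < (n : ℝ) + 1 := by positivity
    rw [hu, lt_div_iff₀ hn]
    linarith [Int.lt_floor_add_one (((n : ℝ) + 1) * t)]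
  have hle : ∀ n t, u n t ≤ t + 1 / ((n : ℝ) + 1) := by
    intro n t
    have hn : (0 : ℝ) < (n : ℝ) + 1 := by positivity
    have e : (t + 1 / ((n : ℝ) + 1)) * ((n : ℝ) + 1) = ((n : ℝ) + 1) * t + 1 := by field_simp
    rw [hu, div_le_iff₀ hn, e]
    linarith [Int.floor_le (((n : ℝ) + 1) * t)]
  refine measurable_of_tendsto_metrizable (f := fun n t => g (u n t)) (fun n => ?_) ?_
  · have h1 : Measurable fun z : ℤ => g (((z : ℝ) + 1) / ((n : ℝ) + 1)) := measurable_from_top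
    exact h1.comp (Int.measurable_floor.comp (measurable_id.const_mul _))
  · rw [tendsto_pi_nhds]
    intro t
    refine (hg t).tendsto.comp (tendsto_nhdsWithin_iff.2 ⟨?_, Eventually.of_forall fun n => hlt n t⟩)
    refine tendsto_of_tendsto_of_tendsto_of_le_of_le tendsto_const_nhds ?_
      (fun n => (hlt n t).le) (fun n => hle n t)
    simpa using tendsto_one_div_add_atTop_nhds_zero_nat.const_add t

/-- A functional of configuration and flux is measurable along a trajectory. -/
theorem Trajectory.measurable_functional (X : Trajectory N) (F : Config N → ℤ → ℝ) :
    Measurable fun S : ℝ => F (X.η (max S 0)) (X.flux (max S 0)) := by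
  refine measurable_of_continuousWithinAt_Ioi fun t => ?_
  refine tendsto_const_nhds.congr' ?_
  rcases le_or_gt 0 t with h | h
  · filter_upwards [X.right_continuous t h, self_mem_nhdsWithin] with s hs hst
    have hst' : t < s := hst
    rw [max_eq_left h, max_eq_left (h.trans hst'.le), hs.1, hs.2]
  · filter_upwards [mem_nhdsWithin_of_mem_nhds (Iio_mem_nhds h)] with s hs
    have hs' : s < 0 := hs
    rw [max_eq_right h.le, max_eq_right hs'.le]

/-- Time is clamped at 0 because nothing is known of a trajectory at negative times. For a fixed
trajectory the stopping time is a fixed number, so stopping multiplies by the indicator of a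
half-line. -/
theorem measurable_canForcing_max [NeZero N] (l : ℕ) (d : Config N → ℝ) (εap δ : ℝ)
    (X : Trajectory N) (y : ZMod N) :
    Measurable fun S : ℝ => canForcing l d εap δ X (max S 0) y := by
  have h1 := X.measurable_functional fun η _ => canE δ (qBar l d) (shift y η)
  have h2 := X.measurable_functional fun η J => -(2 * (N : ℝ) ^ (-(1 / 2) : ℝ) * (J : ℝ) +
    (N : ℝ) ^ (-(1 / 2) : ℝ) * ∑ z ∈ Finset.Icc 1 y.val, spin η (z : ZMod N))
  have hmax : Measurable fun S : ℝ => max S 0 := measurable_id.max measurable_const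
  have h3 : Measurable fun S : ℝ => gartner l d X (max S 0) y :=
    (h2.add (hmax.const_mul (renorm N l d))).exp
  have h4 : Measurable fun S : ℝ => stoppedGartner l d εap X (max S 0) y :=
    h3.indicator (hmax (measurableSet_Iic (a := tSt εap (gartner l d X))))
  exact (h1.const_mul _).mul h4

end Trajectories

/-! ### Increments of the height function -/

section Height

variable {N : ℕ} [NeZero N]

/-- Only the passage from `N - 1` to 0 needs an argument: there the sum on the left is empty, and
the one on the right runs over the whole torus, hence vanishes. -/
theorem sum_Icc_val_add_one {η : Config N} (h0 : ∑ x, spin η x = 0) (x : ZMod N) :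
    ∑ z ∈ Finset.Icc 1 (x + 1).val, spin η (z : ZMod N) =
      ∑ z ∈ Finset.Icc 1 x.val, spin η (z : ZMod N) + spin η (x + 1) := by
  have hN : 0 < N := Nat.pos_of_ne_zero (NeZero.ne N)
  have hstep : ∑ z ∈ Finset.Icc 1 x.val, spin η (z : ZMod N) + spin η (x + 1) =
      ∑ z ∈ Finset.Icc 1 (x.val + 1), spin η (z : ZMod N) := by
    rw [Finset.sum_Icc_succ_top (by omega)]
    simp
  rw [hstep]
  rcases Nat.lt_or_ge (x.val + 1) N with h | h
  · rw [show (x + 1).val = x.val + 1 from ?_]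
    have : ((x.val + 1 : ℕ) : ZMod N) = x + 1 := by simp
    rw [← this, ZMod.val_natCast, Nat.mod_eq_of_lt h]
  · have hx : x.val + 1 = N := le_antisymm (ZMod.val_lt x) h
    have hx0 : x + 1 = 0 := by
      have : ((x.val + 1 : ℕ) : ZMod N) = x + 1 := by simp
      rw [← this, hx, ZMod.natCast_self]
    rw [hx0, hx]
    simp only [ZMod.val_zero]
    have e : ∑ z ∈ Finset.Icc 1 N, spin η (z : ZMod N) = ∑ x, spin η x := by
      -- The range starts at 1, so the residue class 0 is represented by `N`.
      refine Finset.sum_bij' (fun z _ => (z : ZMod N)) (fun x _ => if x.val = 0 then N else x.val)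
        (fun z _ => Finset.mem_univ _) (fun x _ => ?_) (fun z hz => ?_) (fun x _ => ?_)
        (fun z _ => rfl)
      · rw [Finset.mem_Icc]
        have := ZMod.val_lt x
        split_ifs <;> omega
      · rw [Finset.mem_Icc] at hz
        simp only [ZMod.val_natCast]
        rcases hz.2.eq_or_lt with rfl | hlt
        · simp
        · rw [Nat.mod_eq_of_lt hlt, if_neg (by omega)]
      · split_ifs with hv
        · rw [ZMod.natCast_self, (ZMod.val_eq_zero x).1 hv]
        · simp
    rw [e, h0]
    simp

theorem sum_range_spin_sub {η : Config N} (h0 : ∑ x, spin η x = 0) (y : ZMod N) (K : ℕ) :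
    ∑ w ∈ Finset.range K, spin η (y - w) =
      ∑ z ∈ Finset.Icc 1 y.val, spin η (z : ZMod N) -
        ∑ z ∈ Finset.Icc 1 (y - K).val, spin η (z : ZMod N) := by
  induction K with
  | zero => simp
  | succ K ih =>
    rw [Finset.sum_range_succ, ih]
    have h := sum_Icc_val_add_one h0 (y - ((K + 1 : ℕ) : ZMod N))
    have e : y - ((K + 1 : ℕ) : ZMod N) + 1 = y - K := by push_cast; ring
    rw [e] at h
    rw [h]
    ring

/-- The flux term is common to both heights and cancels, leaving a telescoping sum of spins; zero
total spin allows the block to cross the origin. -/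
theorem height_sub_height (X : Trajectory N) {S : ℝ} (h0 : ∑ x, spin (X.η S) x = 0)
    (y : ZMod N) (K : ℕ) :
    (N : ℝ) ^ (1 / 2 : ℝ) * (height X S y - height X S (y - K)) =
      ∑ w ∈ Finset.range K, spin (X.η S) (y - w) := by
  have hN : (0 : ℝ) < N := by exact_mod_cast Nat.pos_of_ne_zero (NeZero.ne N)
  have e : (N : ℝ) ^ (1 / 2 : ℝ) * (N : ℝ) ^ (-(1 / 2) : ℝ) = 1 := by
    rw [← Real.rpow_add hN]; norm_num
  rw [sum_range_spin_sub h0]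
  unfold height
  linear_combination (∑ z ∈ Finset.Icc 1 y.val, spin (X.η S) (z : ZMod N) -
        ∑ z ∈ Finset.Icc 1 (y - K).val, spin (X.η S) (z : ZMod N)) * e

end Height

/-! ### A priori bounds before the stopping time -/

section Stopping

variable {N : ℕ}

theorem not_of_lt_firstTime {P : ℝ → Prop} {t : ℝ} (h0 : 0 ≤ t) (h : t < firstTime P) : ¬P t := by
  have hbdd : BddBelow ({t : ℝ | t ∈ Set.Icc (0 : ℝ) 1 ∧ P t} ∪ {1}) := by
    refine ⟨0, ?_⟩
    rintro s (hs | hs)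
    · exact hs.1.1
    · rw [Set.mem_singleton_iff.1 hs]; norm_num
  intro hP
  -- The default value 1 forces `t` into [0,1], as membership in the defining set requires.
  have h1 : firstTime P ≤ 1 := csInf_le hbdd (Or.inr rfl)
  exact absurd (csInf_le hbdd (Or.inl ⟨⟨h0, h.le.trans h1⟩, hP⟩)) (not_le.2 h)

theorem le_stNorm {s t : ℝ} (hs : s ∈ Set.Icc 0 t) (φ : ℝ → ZMod N → ℝ) (y : ZMod N) :
    ENNReal.ofReal |φ s y| ≤ stNorm t φ :=
  le_iSup₂_of_le s hs (le_iSup_of_le y le_rfl)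

theorem stNorm_le {t : ℝ} {φ : ℝ → ZMod N → ℝ} {K : ℝ}
    (h : ∀ s ∈ Set.Icc (0 : ℝ) t, ∀ y, |φ s y| ≤ K) : stNorm t φ ≤ ENNReal.ofReal K :=
  iSup₂_le fun s hs => iSup_le fun y => ENNReal.ofReal_le_ofReal (h s hs y)

theorem stNorm_add_stNorm_inv_lt {εap : ℝ} {Z : ℝ → ZMod N → ℝ} {S : ℝ} (h0 : 0 ≤ S)
    (h : S < tAp εap Z) :
    stNorm S Z + stNorm S (fun s x => (Z s x)⁻¹) < ENNReal.ofReal ((N : ℝ) ^ εap) :=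
  not_le.1 (not_of_lt_firstTime h0 h)

theorem abs_le_of_lt_tAp {εap : ℝ} {Z : ℝ → ZMod N → ℝ} {S : ℝ} (h0 : 0 ≤ S)
    (h : S < tAp εap Z) (y : ZMod N) :
    |Z S y| ≤ (N : ℝ) ^ εap ∧ |(Z S y)⁻¹| ≤ (N : ℝ) ^ εap := by
  have hlt := (stNorm_add_stNorm_inv_lt h0 h).le
  have ha : (0 : ℝ) ≤ (N : ℝ) ^ εap := Real.rpow_nonneg (Nat.cast_nonneg N) _
  have hS : S ∈ Set.Icc 0 S := ⟨h0, le_rfl⟩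
  constructor
  · exact (ENNReal.ofReal_le_ofReal_iff ha).1
      ((le_stNorm hS Z y).trans (le_self_add.trans hlt))
  · exact (ENNReal.ofReal_le_ofReal_iff ha).1
      ((le_stNorm hS (fun s x => (Z s x)⁻¹) y).trans (le_add_self.trans hlt))

theorem abs_gradX_le_of_lt {εap : ℝ} {Z : ℝ → ZMod N → ℝ} {S : ℝ} (h0 : 0 ≤ S)
    (hap : S < tAp εap Z) (h : S < tSpace εap Z) {k : ℤ} (hk : 1 ≤ |k|)
    (hkN : ((|k| : ℤ) : ℝ) ≤ lenScale N) (y : ZMod N) :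
    (N : ℝ) ^ (1 / 2 : ℝ) * ((|k| : ℤ) : ℝ) ^ (-(1 / 2) : ℝ) * |gradX k Z S y| ≤
      (N : ℝ) ^ εap * (1 + (N : ℝ) ^ εap) ^ 2 := by
  have ha : (0 : ℝ) ≤ (N : ℝ) ^ εap := Real.rpow_nonneg (Nat.cast_nonneg N) _
  have hZ : stNorm S Z ≤ ENNReal.ofReal ((N : ℝ) ^ εap) :=
    le_self_add.trans (stNorm_add_stNorm_inv_lt h0 hap).le
  have hnot := not_of_lt_firstTime h0 h
  have hlt := not_le.1 hnot
  have hw : (0 : ℝ) ≤ (N : ℝ) ^ (1 / 2 : ℝ) * ((|k| : ℤ) : ℝ) ^ (-(1 / 2) : ℝ) :=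
    mul_nonneg (Real.rpow_nonneg (Nat.cast_nonneg N) _)
      (Real.rpow_nonneg (by exact_mod_cast abs_nonneg k) _)
  refine (ENNReal.ofReal_le_ofReal_iff (by positivity)).1 ?_
  calc ENNReal.ofReal ((N : ℝ) ^ (1 / 2 : ℝ) * ((|k| : ℤ) : ℝ) ^ (-(1 / 2) : ℝ) * |gradX k Z S y|)
      = ENNReal.ofReal ((N : ℝ) ^ (1 / 2 : ℝ) * ((|k| : ℤ) : ℝ) ^ (-(1 / 2) : ℝ)) *
          ENNReal.ofReal |gradX k Z S y| := ENNReal.ofReal_mul hw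
    _ ≤ ENNReal.ofReal ((N : ℝ) ^ (1 / 2 : ℝ) * ((|k| : ℤ) : ℝ) ^ (-(1 / 2) : ℝ)) *
          stNorm S (gradX k Z) := mul_le_mul_right (le_stNorm ⟨h0, le_rfl⟩ (gradX k Z) y) _
    _ ≤ _ := le_iSup₂_of_le k ⟨hk, hkN⟩ le_rfl
    _ ≤ ENNReal.ofReal ((N : ℝ) ^ εap) * (1 + stNorm S Z) ^ 2 := hlt.le
    _ ≤ ENNReal.ofReal ((N : ℝ) ^ εap) * (1 + ENNReal.ofReal ((N : ℝ) ^ εap)) ^ 2 := by gcongr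
    _ = ENNReal.ofReal ((N : ℝ) ^ εap * (1 + (N : ℝ) ^ εap) ^ 2) := by
        rw [ENNReal.ofReal_mul ha, ENNReal.ofReal_pow (by positivity),
          ENNReal.ofReal_add zero_le_one ha, ENNReal.ofReal_one]

/-- The inequality log r ≤ r - 1, applied to both quotients, makes the logarithm Lipschitz with
constant `a` on the half-line [1/a, ∞). -/
theorem abs_log_sub_log_le {z w a : ℝ} (hz : 0 < z) (hw : 0 < w) (hza : z⁻¹ ≤ a) (hwa : w⁻¹ ≤ a) :
    |Real.log z - Real.log w| ≤ |z - w| * a := by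
  have key : ∀ {u v : ℝ}, 0 < u → 0 < v → v⁻¹ ≤ a → Real.log u - Real.log v ≤ |u - v| * a := by
    intro u v hu hv hva
    rw [← Real.log_div hu.ne' hv.ne']
    have h1 := Real.log_le_sub_one_of_pos (div_pos hu hv)
    have h2 : u / v - 1 = (u - v) * v⁻¹ := by field_simp
    calc Real.log (u / v) ≤ (u - v) * v⁻¹ := by linarith
      _ ≤ |u - v| * v⁻¹ := mul_le_mul_of_nonneg_right (le_abs_self _) (inv_nonneg.2 hv.le)
      _ ≤ _ := mul_le_mul_of_nonneg_left hva (abs_nonneg _)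
  rw [abs_le]
  constructor
  · have := key hw hz hza
    rw [abs_sub_comm] at this
    linarith
  · exact key hz hw hwa

variable [NeZero N]

/-- Before the stopping time, block sums of spins are of the order of the square root of the
block length. -/
theorem abs_sum_spin_le {l : ℕ} {d : Config N → ℝ} {εap : ℝ} (hεap : 0 ≤ εap) {X : Trajectory N}
    {S : ℝ} (h0 : 0 ≤ S) (hS : S < tSt εap (gartner l d X)) (hX : ∑ x, spin (X.η S) x = 0) {K : ℕ}
    (hK : 1 ≤ K) (hKN : (K : ℝ) ≤ lenScale N) (y : ZMod N) :
    |∑ w ∈ Finset.range K, spin (X.η S) (y - w)| ≤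
      4 * ((N : ℝ) ^ εap) ^ 4 * (K : ℝ) ^ (1 / 2 : ℝ) := by
  obtain ⟨hap, h2⟩ := lt_min_iff.1 hS
  obtain ⟨-, hsp⟩ := lt_min_iff.1 h2
  have hN1 : (1 : ℝ) ≤ N := by exact_mod_cast Nat.one_le_iff_ne_zero.2 (NeZero.ne N)
  have hK0 : (0 : ℝ) < K := by exact_mod_cast hK
  set a : ℝ := (N : ℝ) ^ εap with ha
  have ha1 : 1 ≤ a := Real.one_le_rpow hN1 hεap
  set Z := gartner l d X with hZ
  have hpos : ∀ x, 0 < Z S x := fun x => Real.exp_pos _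
  have hinv : ∀ x, (Z S x)⁻¹ ≤ a := fun x =>
    (le_abs_self _).trans (abs_le_of_lt_tAp h0 hap x).2
  have habsK : |(-(K : ℤ))| = (K : ℤ) := by rw [abs_neg, Nat.abs_cast]
  -- The increment is negative because the block extends to the left of `y`.
  have hg := abs_gradX_le_of_lt h0 hap hsp (k := -(K : ℤ))
    (by rw [habsK]; exact_mod_cast hK) (by rw [habsK]; exact_mod_cast hKN) y
  rw [habsK, ← ha] at hg
  have hgr : gradX (-(K : ℤ)) Z S y = Z S (y - K) - Z S y := by
    simp [gradX, sub_eq_add_neg]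
  rw [hgr] at hg
  have hlog : |height X S y - height X S (y - K)| ≤ |Z S (y - K) - Z S y| * a := by
    have := abs_log_sub_log_le (hpos (y - K)) (hpos y) (hinv _) (hinv _)
    have e : Real.log (Z S (y - K)) - Real.log (Z S y) =
        height X S y - height X S (y - K) := by
      simp only [hZ, gartner, Real.log_exp]; ring
    rwa [e] at this
  have hsqN : (0 : ℝ) ≤ (N : ℝ) ^ (1 / 2 : ℝ) := Real.rpow_nonneg (by linarith) _
  have hKK : (K : ℝ) ^ (-(1 / 2) : ℝ) * (K : ℝ) ^ (1 / 2 : ℝ) = 1 := by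
    rw [← Real.rpow_add hK0]; norm_num
  have hsqK : (0 : ℝ) ≤ (K : ℝ) ^ (1 / 2 : ℝ) := Real.rpow_nonneg hK0.le _
  rw [← height_sub_height X hX, abs_mul, abs_of_nonneg hsqN]
  push_cast at hg
  calc (N : ℝ) ^ (1 / 2 : ℝ) * |height X S y - height X S (y - K)|
      ≤ (N : ℝ) ^ (1 / 2 : ℝ) * (|Z S (y - K) - Z S y| * a) := by gcongr
    _ = ((N : ℝ) ^ (1 / 2 : ℝ) * (K : ℝ) ^ (-(1 / 2) : ℝ) * |Z S (y - K) - Z S y|) * a *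
          (K : ℝ) ^ (1 / 2 : ℝ) := by linear_combination (-(N : ℝ) ^ (1 / 2 : ℝ) *
            |Z S (y - K) - Z S y| * a) * hKK
    -- Three powers of `a` come from the gradient threshold and one from the logarithm; 1 + a ≤ 2a
    -- produces the 4.
    _ ≤ (a * (1 + a) ^ 2) * a * (K : ℝ) ^ (1 / 2 : ℝ) := by gcongr
    _ ≤ (a * (2 * a) ^ 2) * a * (K : ℝ) ^ (1 / 2 : ℝ) := by gcongr; linarith
    _ = _ := by ring

theorem blockAvg_sq_le {l : ℕ} {d : Config N → ℝ} {εap : ℝ} (hεap : 0 ≤ εap) {X : Trajectory N}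
    {S : ℝ} (h0 : 0 ≤ S) (hS : S < tSt εap (gartner l d X)) (hX : ∑ x, spin (X.η S) x = 0)
    {δ : ℝ} (hδ0 : 0 ≤ δ) (hδ : δ ≤ 1 / 2 + epsRN) (y : ZMod N) :
    blockAvg δ (shift y (X.η S)) ^ 2 ≤
      25 * ((N : ℝ) ^ εap) ^ 8 / ((⌊(N : ℝ) ^ δ⌋₊ + 1 : ℕ) : ℝ) := by
  have hN1 : (1 : ℝ) ≤ N := by exact_mod_cast Nat.one_le_iff_ne_zero.2 (NeZero.ne N)
  have hNδ : 1 ≤ (N : ℝ) ^ δ := Real.one_le_rpow hN1 hδ0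
  set K := ⌊(N : ℝ) ^ δ⌋₊ with hK
  have hK1 : 1 ≤ K := Nat.one_le_floor_iff _ |>.2 hNδ
  have hKN : (K : ℝ) ≤ lenScale N :=
    (Nat.floor_le (by linarith)).trans (Real.rpow_le_rpow_of_exponent_le hN1 hδ)
  set a : ℝ := (N : ℝ) ^ εap with ha
  have ha1 : 1 ≤ a := Real.one_le_rpow hN1 hεap
  have hb := abs_sum_spin_le hεap h0 hS hX hK1 hKN y
  rw [← ha, ← Real.sqrt_eq_rpow] at hb
  have hM : (0 : ℝ) < ((K + 1 : ℕ) : ℝ) := by positivity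
  have e : blockAvg δ (shift y (X.η S)) =
      (∑ w ∈ Finset.range (K + 1), spin (X.η S) (y - w)) / ((K + 1 : ℕ) : ℝ) := by
    unfold blockAvg
    rw [← hK]
    congr 1
    refine Finset.sum_congr rfl fun w _ => ?_
    simp only [spin, shift]
    rw [neg_add_eq_sub]
  have hKM : √(K : ℝ) ≤ √((K + 1 : ℕ) : ℝ) := Real.sqrt_le_sqrt (by push_cast; linarith)
  have h1M : 1 ≤ √((K + 1 : ℕ) : ℝ) := Real.one_le_sqrt.2 (by push_cast; linarith [Nat.cast_nonneg (α := ℝ) K])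
  have ha4 : 1 ≤ a ^ 4 := one_le_pow₀ ha1
  -- The block has `K + 1` sites, a length that may exceed `lenScale N`. The gradient bound is used
  -- for `K` sites and the last spin is bounded by 1, so 4 becomes 5, and 25 after squaring.
  have hsum : |∑ w ∈ Finset.range (K + 1), spin (X.η S) (y - w)| ≤
      5 * a ^ 4 * √((K + 1 : ℕ) : ℝ) := by
    rw [Finset.sum_range_succ]
    refine (abs_add_le _ _).trans ?_
    rw [abs_spin]
    have h1 : 4 * a ^ 4 * √(K : ℝ) ≤ 4 * a ^ 4 * √((K + 1 : ℕ) : ℝ) := by gcongr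
    have h2 : 1 ≤ a ^ 4 * √((K + 1 : ℕ) : ℝ) := one_le_mul_of_one_le_of_one_le ha4 h1M
    linarith
  have hsq : (∑ w ∈ Finset.range (K + 1), spin (X.η S) (y - w)) ^ 2 ≤
      25 * a ^ 8 * ((K + 1 : ℕ) : ℝ) := by
    rw [← sq_abs]
    refine (pow_le_pow_left₀ (abs_nonneg _) hsum 2).trans (le_of_eq ?_)
    rw [mul_pow, Real.sq_sqrt hM.le]
    ring
  rw [e, div_pow, div_le_div_iff₀ (by positivity) hM]
  calc _ ≤ 25 * a ^ 8 * ((K + 1 : ℕ) : ℝ) * ((K + 1 : ℕ) : ℝ) := by gcongr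
    _ = _ := by ring

end Stopping

/-! ### The heat operator applied to the canonical forcing -/

section HeatOperator

variable {N : ℕ} [NeZero N]

/-- The pointwise bound on the canonical forcing before the stopping time. -/
theorem abs_canForcing_le {l : ℕ} (hl : 1 ≤ l) {d : Config N → ℝ}
    (hd : DependsOn d (centeredBlock N l)) {B : ℝ} (hB : ∀ η, |d η| ≤ B) {εap : ℝ}
    (hεap : 0 ≤ εap) {δ : ℝ} (hδ0 : 0 ≤ δ) (hδ : δ ≤ 1 / 2 + epsRN)
    (hδN : ⌊(N : ℝ) ^ δ⌋₊ + 1 ≤ N) (hlδ : 2 * (3 * l + 1) ≤ ⌊(N : ℝ) ^ δ⌋₊ + 1)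
    {X : Trajectory N} (hX : ∑ x, spin (X.η 0) x = 0) {S : ℝ} (h0 : 0 ≤ S)
    (hS : S ≠ tSt εap (gartner l d X)) (y : ZMod N) :
    |canForcing l d εap δ X S y| ≤
      26 * (8 ^ (3 * l + 1) * B) * (N : ℝ) ^ (1 / 2 - δ + 9 * εap) := by
  have hN : (0 : ℝ) < N := by exact_mod_cast Nat.pos_of_ne_zero (NeZero.ne N)
  have hN1 : (1 : ℝ) ≤ N := by exact_mod_cast Nat.one_le_iff_ne_zero.2 (NeZero.ne N)
  have hB0 : 0 ≤ B := (abs_nonneg _).trans (hB 1)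
  have hrhs : 0 ≤ 26 * (8 ^ (3 * l + 1) * B) * (N : ℝ) ^ (1 / 2 - δ + 9 * εap) := by positivity
  rcases lt_or_ge (tSt εap (gartner l d X)) S with h | h
  · have : stoppedGartner l d εap X S y = 0 := Set.indicator_of_notMem (by simpa using h) _
    rw [canForcing, this, mul_zero, abs_zero]
    exact hrhs
  have hlt := lt_of_le_of_ne h hS
  have hXS : ∑ x, spin (X.η S) x = 0 := (X.sum_spin_eq h0).trans hX
  have hY : |stoppedGartner l d εap X S y| ≤ (N : ℝ) ^ εap := by
    have : stoppedGartner l d εap X S y = gartner l d X S y := Set.indicator_of_mem (by simpa using h) _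
    rw [this]
    exact (abs_le_of_lt_tAp h0 (lt_min_iff.1 hlt).1 y).1
  have hA := blockAvg_sq_le hεap h0 hlt hXS hδ0 hδ y
  have hc := abs_canE_qBar_le hl hδN hlδ hd hB (shift y (X.η S))
  set M : ℝ := ((⌊(N : ℝ) ^ δ⌋₊ + 1 : ℕ) : ℝ) with hM
  set a : ℝ := (N : ℝ) ^ εap with ha
  have ha1 : 1 ≤ a := Real.one_le_rpow hN1 hεap
  have hNδ : 0 < (N : ℝ) ^ δ := Real.rpow_pos_of_pos hN δ
  have hMδ : (N : ℝ) ^ δ ≤ M := by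
    rw [hM]; push_cast; exact (Nat.lt_floor_add_one _).le
  have hM0 : 0 < M := hNδ.trans_le hMδ
  have hQ : blockAvg δ (shift y (X.η S)) ^ 2 + 1 / M ≤ 26 * a ^ 8 / (N : ℝ) ^ δ := by
    have h1 : 1 / M ≤ a ^ 8 / M := by gcongr; exact one_le_pow₀ ha1
    calc _ ≤ 25 * a ^ 8 / M + a ^ 8 / M := add_le_add hA h1
      _ = 26 * a ^ 8 / M := by ring
      _ ≤ _ := by gcongr
  have hsq : (0 : ℝ) ≤ (N : ℝ) ^ (1 / 2 : ℝ) := Real.rpow_nonneg hN.le _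
  -- Eight powers come from the squared block average and the ninth from the stopped transform.
  have ha9 : a ^ 9 = (N : ℝ) ^ (9 * εap) := by
    rw [ha, ← Real.rpow_natCast, ← Real.rpow_mul hN.le]; congr 1; push_cast; ring
  rw [canForcing, abs_mul, abs_mul, abs_of_nonneg hsq]
  calc (N : ℝ) ^ (1 / 2 : ℝ) * |canE δ (qBar l d) (shift y (X.η S))| *
        |stoppedGartner l d εap X S y|
      ≤ (N : ℝ) ^ (1 / 2 : ℝ) * (8 ^ (3 * l + 1) * B * (26 * a ^ 8 / (N : ℝ) ^ δ)) * a := by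
        have : |canE δ (qBar l d) (shift y (X.η S))| ≤
            8 ^ (3 * l + 1) * B * (26 * a ^ 8 / (N : ℝ) ^ δ) := hc.trans (by gcongr)
        gcongr
    _ = 26 * (8 ^ (3 * l + 1) * B) * ((N : ℝ) ^ (1 / 2 : ℝ) / (N : ℝ) ^ δ * a ^ 9) := by ring
    _ = _ := by rw [ha9, ← Real.rpow_sub hN, ← Real.rpow_add hN]

/-- The exceptional time `t₀` will be the stopping time: the process is not yet cut off there, while
the thresholds are only known to hold strictly before. A single time is negligible in the integral.
-/
theorem intervalIntegrable_and_abs_heatOp_le {a : ℝ} (ha : 0 ≤ (N : ℝ) + 2 * a)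
    {φ : ℝ → ZMod N → ℝ} (hφm : ∀ y, Measurable fun S => φ (max S 0) y) {K t₀ : ℝ}
    (hφ : ∀ S, 0 ≤ S → S ≠ t₀ → ∀ y, |φ S y| ≤ K) {T : ℝ} (hT : 0 ≤ T) (x : ZMod N) :
    IntervalIntegrable (fun S => ∑ y, heatKernel N a S T x y * φ S y) MeasureTheory.volume 0 T ∧
      |heatOp N a φ T x| ≤ K * T := by
  have hbound : ∀ᵐ S : ℝ, S ∈ Set.uIoc 0 T → ‖∑ y, heatKernel N a S T x y * φ S y‖ ≤ K := by
    have hne : ∀ᵐ S : ℝ, S ≠ t₀ := by simp [MeasureTheory.ae_iff]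
    filter_upwards [hne] with S hS hST
    rw [Set.uIoc_of_le hT] at hST
    exact abs_sum_heatKernel_mul_le ha hST.2 x (hφ S hST.1.le hS)
  constructor
  · rw [intervalIntegrable_iff]
    have hmeas : MeasureTheory.AEStronglyMeasurable
        (fun S => ∑ y, heatKernel N a S T x y * φ S y)
        (MeasureTheory.volume.restrict (Set.uIoc 0 T)) := by
      have hm : Measurable fun S => ∑ y, heatKernel N a S T x y * φ (max S 0) y :=
        Finset.measurable_fun_sum _ fun y _ =>
          (continuous_heatKernel_left a T x y).measurable.mul (hφm y)
      refine hm.aestronglyMeasurable.congr ?_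
      filter_upwards [MeasureTheory.ae_restrict_mem measurableSet_uIoc] with S hS
      rw [Set.uIoc_of_le hT] at hS
      rw [max_eq_left hS.1.le]
    exact MeasureTheory.IntegrableOn.of_bound (by simp [Set.uIoc]) hmeas K
      ((MeasureTheory.ae_restrict_iff' measurableSet_uIoc).2 hbound)
  · have h := intervalIntegral.norm_integral_le_of_norm_le_const_ae hbound
    rwa [sub_zero, abs_of_nonneg hT] at h

end HeatOperator

/-! ### Numerical bounds on exponents and block lengths -/

theorem epsRN_pos : 0 < epsRN := by unfold epsRN; positivity

theorem epsRN_le : epsRN ≤ 1 / 4 := by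
  unfold epsRN
  rw [one_div]
  refine inv_anti₀ (by norm_num) ?_
  calc (4 : ℝ) ≤ 999 := by norm_num
    _ ≤ 999 ^ 999 := le_self_pow₀ (by norm_num) (by norm_num)

theorem inv_pow_mul_epsRN_le : ((999 : ℝ) ^ 999)⁻¹ * epsRN ≤ epsRN / 100 := by
  have h : ((999 : ℝ) ^ 999)⁻¹ ≤ 1 / 100 := by
    rw [one_div]
    refine inv_anti₀ (by norm_num) ?_
    calc (100 : ℝ) ≤ 999 := by norm_num
      _ ≤ 999 ^ 999 := le_self_pow₀ (by norm_num) (by norm_num)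
  exact (mul_le_mul_of_nonneg_right h epsRN_pos.le).trans_eq (one_div_mul_eq_div _ _)

theorem floor_rpow_add_one_le {N : ℕ} (hN : 16 ≤ N) {δ : ℝ} (hδ : δ ≤ 3 / 4) :
    ⌊(N : ℝ) ^ δ⌋₊ + 1 ≤ N := by
  have hN' : (16 : ℝ) ≤ N := by exact_mod_cast hN
  have hN0 : (0 : ℝ) < N := by linarith
  have h2 : (2 : ℝ) ≤ (N : ℝ) ^ (1 / 4 : ℝ) := by
    calc (2 : ℝ) = (16 : ℝ) ^ (1 / 4 : ℝ) := by
          rw [show (16 : ℝ) = 2 ^ (4 : ℝ) by norm_num, ← Real.rpow_mul (by norm_num)]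
          norm_num
      _ ≤ _ := Real.rpow_le_rpow (by norm_num) hN' (by norm_num)
  have hmul : (N : ℝ) ^ (3 / 4 : ℝ) * (N : ℝ) ^ (1 / 4 : ℝ) = N := by
    rw [← Real.rpow_add hN0]; norm_num
  have h34 : 0 ≤ (N : ℝ) ^ (3 / 4 : ℝ) := Real.rpow_nonneg hN0.le _
  have h1 : (N : ℝ) ^ δ ≤ (N : ℝ) ^ (3 / 4 : ℝ) :=
    Real.rpow_le_rpow_of_exponent_le (by linarith) hδ
  have hfl : (⌊(N : ℝ) ^ δ⌋₊ : ℝ) ≤ (N : ℝ) ^ δ := Nat.floor_le (Real.rpow_nonneg hN0.le _)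
  have : ((⌊(N : ℝ) ^ δ⌋₊ + 1 : ℕ) : ℝ) ≤ N := by
    push_cast
    nlinarith
  exact_mod_cast this

theorem le_floor_rpow {N m : ℕ} (hN : 1 ≤ N) (hm : m ^ 2 ≤ N) {δ : ℝ} (hδ : 1 / 2 ≤ δ) :
    m ≤ ⌊(N : ℝ) ^ δ⌋₊ := by
  refine Nat.le_floor ?_
  calc (m : ℝ) = √((m : ℝ) ^ 2) := (Real.sqrt_sq (Nat.cast_nonneg m)).symm
    _ ≤ √(N : ℝ) := Real.sqrt_le_sqrt (by exact_mod_cast hm)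
    _ = (N : ℝ) ^ (1 / 2 : ℝ) := Real.sqrt_eq_rpow _
    _ ≤ _ := Real.rpow_le_rpow_of_exponent_le (by exact_mod_cast hN) hδ

end SpeedChangeKPZ

end

/-! ### The proposition -/

theorem proposition4p5 (l : ℕ) (hl : 1 ≤ l) (B : ℝ) :
    ∃ C : ℝ, 0 < C ∧ ∃ N₀ : ℕ, ∀ (N : ℕ) [NeZero N], N₀ ≤ N →
      ∀ d : Config N → ℝ, DependsOn d (centeredBlock N l) → (∀ η, |d η| ≤ B) →
      ∀ ε₁ εRN1 εap : ℝ, 0 < ε₁ → 0 < εRN1 → εRN1 ≤ ((999 : ℝ) ^ 999)⁻¹ * epsRN →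
        0 < εap → (999 : ℝ) ^ 999 * εap ≤ epsRN →
      ∀ b : ℕ, IsGreatest {b' : ℕ | ε₁ + (b' : ℝ) * εRN1 ≤ 1 / 2 + epsRN} b →
      ∀ X : Trajectory N, ∑ x, spin (X.η 0) x = 0 →
        (∀ T ∈ Set.Icc (0 : ℝ) 1, ∀ x : ZMod N,
          IntervalIntegrable
            (fun S => ∑ y, heatKernel N (dBar l d) S T x y *
              canForcing l d εap (ε₁ + (b : ℝ) * εRN1) X S y)
            MeasureTheory.volume 0 T) ∧
        stNorm 1 (heatOp N (dBar l d) (canForcing l d εap (ε₁ + (b : ℝ) * εRN1) X)) ≤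
          ENNReal.ofReal (C * (N : ℝ) ^ (-(99 / 100) * epsRN + 10 * εap)) := by
  -- The added 1 keeps the constant positive when `B = 0`. The three summands of the threshold
  -- serve, in order, to fit the block in the torus, to make it at least twice as long as the
  -- support of `qTilde`, and to make the heat kernel nonnegative.
  refine ⟨26 * (8 ^ (3 * l + 1) * |B|) + 1, by positivity,
    16 + (2 * (3 * l + 1)) ^ 2 + ⌈2 * (2 ^ (3 * l + 1) * |B|)⌉₊, ?_⟩
  intro N _ hN d hd hB ε₁ εRN1 εap hε₁ hεRN1 hεRN1' hεap hεap' b hb X hX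
  have hB' : ∀ η, |d η| ≤ |B| := fun η => (hB η).trans (le_abs_self B)
  have hN1 : (1 : ℝ) ≤ N := by exact_mod_cast (by omega : 1 ≤ N)
  have hsmall : εRN1 ≤ epsRN / 100 := hεRN1'.trans inv_pow_mul_epsRN_le
  clear hεRN1' hεap'
  set δ : ℝ := ε₁ + (b : ℝ) * εRN1 with hδdef
  have hδle : δ ≤ 1 / 2 + epsRN := hb.1
  have hδge : 1 / 2 + epsRN - epsRN / 100 ≤ δ := by
    -- If δ were smaller, one more step, of length at most `epsRN / 100`, would still be admissible,
    -- against maximality of `b`. This is the source of the factor 99/100.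
    by_contra hlt
    have hmem : b + 1 ∈ {b' : ℕ | ε₁ + (b' : ℝ) * εRN1 ≤ 1 / 2 + epsRN} := by
      rw [Set.mem_ofPred_eq]
      push_cast
      linarith
    have := hb.2 hmem
    omega
  have hpos := epsRN_pos
  have hδhalf : 1 / 2 ≤ δ := by linarith
  have hδN : ⌊(N : ℝ) ^ δ⌋₊ + 1 ≤ N :=
    floor_rpow_add_one_le (by omega) (by linarith [epsRN_le])
  have hlδ : 2 * (3 * l + 1) ≤ ⌊(N : ℝ) ^ δ⌋₊ + 1 :=
    (le_floor_rpow (by omega) (by omega) hδhalf).trans (Nat.le_succ _)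
  have hdBar : 0 ≤ (N : ℝ) + 2 * dBar l d := by
    have h1 := (abs_le.1 (abs_dBar_le hl (by omega) hd hB')).1
    have h2 : 2 * (2 ^ (3 * l + 1) * |B|) ≤ (N : ℝ) :=
      (Nat.le_ceil _).trans (Nat.cast_le.2 ((Nat.le_add_left _ _).trans hN))
    linarith
  have hforce : ∀ S, 0 ≤ S → S ≠ tSt εap (gartner l d X) → ∀ y,
      |canForcing l d εap δ X S y| ≤
        (26 * (8 ^ (3 * l + 1) * |B|) + 1) * (N : ℝ) ^ (-(99 / 100) * epsRN + 10 * εap) := by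
    intro S h0 hS y
    refine (abs_canForcing_le hl hd hB' hεap.le (by linarith) hδle hδN hlδ hX h0 hS y).trans ?_
    have : (N : ℝ) ^ (1 / 2 - δ + 9 * εap) ≤ (N : ℝ) ^ (-(99 / 100) * epsRN + 10 * εap) :=
      Real.rpow_le_rpow_of_exponent_le hN1 (by linarith)
    gcongr
    linarith
  have main := fun (T : ℝ) (hT : T ∈ Set.Icc (0 : ℝ) 1) (x : ZMod N) =>
    intervalIntegrable_and_abs_heatOp_le hdBar (measurable_canForcing_max l d εap δ X) hforce hT.1 x
  refine ⟨fun T hT x => (main T hT x).1, stNorm_le fun T hT x => (main T hT x).2.trans ?_⟩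
  exact mul_le_of_le_one_right (by positivity) hT.2
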